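/- Positive logic. A formula is a positive existential formula (built from atomic formulas, including equality, by $\wedge,\vee,\top,\bot,\exists$); a theory is a set of h-inductive sentences $\forall x(\varphi(x)\to\psi(x))$ with $\varphi,\psi$ formulas. Tuples may be infinite; "small" means of cardinality $<\bar\kappa$. Let $T$ be a theory with the joint embedding property in a one-sorted signature $\mathcal L$, with monster model $\mathfrak M$: an existentially closed model of $T$ in which every partial immersion between small sets extends to an automorphism, and every finitely satisfiable small set of formulas over $\mathfrak M$ is satisfiable. A partial type in $T$ is a set of formulas consistent with $T$, a type in $T$ is a maximal such set, and $\operatorname{tp}(a)$ is the set of formulas without parameters true of $a$ in the monster model. Variables range over small tuples. Call $T$ * *Hausdorff* if for any two distinct types $p(x),q(x)$ there are $\varphi\notin p$ and $\psi\notin q$ with $\mathfrak M\models\forall x(\varphi(x)\vee\psi(x))$; * *semi-Hausdorff* if for every tuple of variables $x$ there is a partial type $\Omega(x,y)$ such that $\operatorname{tp}(a)=\operatorname{tp}(b)$ if and only if $\mathfrak M\models\Omega(a,b)$; * *thick* if for every tuple of variables $x$ there is a partial type $\Theta((x_i)_{i<\omega})$ such that $(a_i)_{i<\omega}$ is indiscernible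 if and only if $\mathfrak M\models\Theta((a_i)_{i<\omega})$. Let $\mathcal E$ be a set of partial types $E(x,y)$ without parameters, with $x,y$ tuples of the same small length depending on $E$, each defining an equivalence relation in $\mathfrak M$. Let $\mathcal L_{\mathcal E}$ be the many-sorted extension of $\mathcal L$ that has, besides the real sort of $\mathcal L$, a sort $S_E$ for each $E\in\mathcal E$, and a relation symbol $R_\varphi(x,y_1,\dots,y_m)$ for all $E_1,\dots,E_m\in\mathcal E$ and each $\mathcal L$-formula $\varphi(x,y_{1,r},\dots,y_{m,r})$, where $x$ is a finite real tuple, $y_j$ has sort $S_{E_j}$ and $y_{j,r}$ is a tuple of real variables of the length of the representatives of $E_j$-classes. Let $\mathfrak M^{\mathcal E}$ be the $\mathcal L_{\mathcal E}$-structure with real sort $\mathfrak M$ and $S_E=\mathfrak M^{|x|}/E$ in which $R_\varphi(a,c_1,\dots,c_m)$ holds if and only if $\mathfrak M\models\varphi(a,b_1,\dots,b_m)$ for some representatives $b_j$ of $c_j$. Let $T^{\mathcal E}$, the hyperimaginary extension of $T$, be the set of all h-inductive $\mathcal L_{\mathcal E}$-sentences true in $\mathfrak M^{\mathcal E}$;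 its properties are evaluated with $\mathfrak M^{\mathcal E}$ in the role of the monster model. Assume that $\bar\kappa$ is sufficiently large, namely $\bar\kappa>\beth_{(2^\mu)^+}$ for some infinite cardinal $\mu$ that is at least the number of symbols of $\mathcal L$ and at least the length of the tuples $x$ in each $E(x,y)\in\mathcal E$. If $T$ is Hausdorff (respectively semi-Hausdorff, thick), then so is $T^{\mathcal E}$. -/

import Mathlib

open Cardinal

universe u w

namespace PosLogic

/-- A many-sorted signature with set of sorts `S`. Arities are finite and indexed by finite types.
Equality is a logical symbol, available in every sort. -/
structure Signature (S : Type u) where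
  /-- function symbols -/
  Func : Type u
  /-- the finite set of argument places of a function symbol -/
  FuncArg : Func → Type
  finite_funcArg : ∀ f, Finite (FuncArg f)
  /-- the sorts of the arguments -/
  dom : ∀ f, FuncArg f → S
  /-- the sort of the value -/
  cod : Func → S
  /-- relation symbols -/
  Rel : Type u
  /-- the finite set of argument places of a relation symbol -/
  RelArg : Rel → Type
  finite_relArg : ∀ R, Finite (RelArg R)
  /-- the sorts of the arguments -/
  rdom : ∀ R, RelArg R → S

variable {S : Type u}

/-- Terms whose variables are the elements `x` of `X`, the variable `x` being of sort `σ x`. -/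
inductive Term (L : Signature S) {X : Type w} (σ : X → S) : S → Type (max u w)
  | var (x : X) : Term L σ (σ x)
  | app (f : L.Func) (ts : ∀ i : L.FuncArg f, Term L σ (L.dom f i)) : Term L σ (L.cod f)

/-- Sorts of the variables when the free variables `X` are joined by a list `Γ` of bound ones. -/
abbrev ctx {X : Type w} (σ : X → S) (Γ : List S) : X ⊕ Fin Γ.length → S :=
  Sum.elim σ Γ.get

/-- Positive existential formulas with free variables in `X` (sorted by `σ`) and de Bruijn bound
variables, whose sorts are listed in `Γ`. -/
inductive BFormula (L : Signature S) {X : Type w} (σ : X → S) : List S → Type (max u w)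
  | top {Γ : List S} : BFormula L σ Γ
  | bot {Γ : List S} : BFormula L σ Γ
  | equal {Γ : List S} {s : S} (t₁ t₂ : Term L (ctx σ Γ) s) : BFormula L σ Γ
  | rel {Γ : List S} (R : L.Rel) (ts : ∀ i : L.RelArg R, Term L (ctx σ Γ) (L.rdom R i)) :
      BFormula L σ Γ
  | and {Γ : List S} (φ ψ : BFormula L σ Γ) : BFormula L σ Γ
  | or {Γ : List S} (φ ψ : BFormula L σ Γ) : BFormula L σ Γ
  | ex {Γ : List S} (s : S) (φ : BFormula L σ (s :: Γ)) : BFormula L σ Γ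

/-- Positive existential formulas `φ(x)` in the tuple of variables `x = (x)_{x ∈ X}`. -/
abbrev Formula (L : Signature S) {X : Type w} (σ : X → S) : Type (max u w) := BFormula L σ []

/-- Structures for a many-sorted signature. -/
structure Str (L : Signature S) where
  carrier : S → Type u
  func : ∀ f : L.Func, (∀ i : L.FuncArg f, carrier (L.dom f i)) → carrier (L.cod f)
  rel : ∀ R : L.Rel, (∀ i : L.RelArg R, carrier (L.rdom R i)) → Prop

namespace Str

variable {L : Signature S} (M : Str L)

/-- Tuples of elements of `M`, of the sorts prescribed by `σ`. -/
abbrev Tuple {X : Type w} (σ : X → S) : Type (max u w) := ∀ x : X, M.carrier (σ x)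

/-- Concatenation of two tuples. -/
def append {X : Type*} {Y : Type*} {σ : X → S} {τ : Y → S} (a : M.Tuple σ) (b : M.Tuple τ) :
    M.Tuple (Sum.elim σ τ)
  | Sum.inl x => a x
  | Sum.inr y => b y

/-- Value of a term. -/
def eval {X : Type w} {σ : X → S} (v : M.Tuple σ) : {s : S} → Term L σ s → M.carrier s
  | _, .var x => v x
  | _, .app f ts => M.func f fun i => eval v (ts i)

/-- Truth of a formula under an assignment of its free and bound variables. -/
def BRealize {X : Type w} {σ : X → S} (v : M.Tuple σ) :
    {Γ : List S} → BFormula L σ Γ → M.Tuple Γ.get → Prop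
  | _, .top, _ => True
  | _, .bot, _ => False
  | _, .equal t₁ t₂, xs => M.eval (M.append v xs) t₁ = M.eval (M.append v xs) t₂
  | _, .rel R ts, xs => M.rel R fun i => M.eval (M.append v xs) (ts i)
  | _, .and φ ψ, xs => BRealize v φ xs ∧ BRealize v ψ xs
  | _, .or φ ψ, xs => BRealize v φ xs ∨ BRealize v ψ xs
  | Γ, .ex s φ, xs => ∃ c : M.carrier s,
      BRealize v φ (Fin.cons (α := fun i => M.carrier ((s :: Γ).get i)) c xs)

/-- `M ⊨ φ(a)`. -/
def Realize {X : Type w} {σ : X → S} (φ : Formula L σ) (a : M.Tuple σ) : Prop :=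
  M.BRealize a φ (fun i => i.elim0)

/-- `M ⊨ Σ(a)` for a set of formulas. -/
def RealizeSet {X : Type w} {σ : X → S} (Φ : Set (Formula L σ)) (a : M.Tuple σ) : Prop :=
  ∀ φ ∈ Φ, M.Realize φ a

/-- The positive existential type `tp(a)` (over `∅`) of a tuple. -/
def tp {X : Type w} {σ : X → S} (a : M.Tuple σ) : Set (Formula L σ) := {φ | M.Realize φ a}

/-- A sort-preserving bijection of `M` is an automorphism if it preserves functions and preserves
and reflects relations. -/
def IsAutomorphism (f : ∀ s, M.carrier s ≃ M.carrier s) : Prop :=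
  (∀ (g : L.Func) (a : ∀ i, M.carrier (L.dom g i)),
      f _ (M.func g a) = M.func g fun i => f _ (a i)) ∧
  ∀ (R : L.Rel) (a : ∀ i, M.carrier (L.rdom R i)), M.rel R (fun i => f _ (a i)) ↔ M.rel R a

/-- `(a_i)_{i < ω}` is indiscernible (over `∅`): `tp(a_{i_1} … a_{i_n}) = tp(a_{j_1} … a_{j_n})`
whenever `i_1 < … < i_n` and `j_1 < … < j_n`. -/
def Indiscernible {X : Type w} {σ : X → S} (a : ℕ → M.Tuple σ) : Prop :=
  ∀ (n : ℕ) (i j : Fin n → ℕ), StrictMono i → StrictMono j →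
    M.tp (σ := fun p : Fin n × X => σ p.2) (fun p => a (i p.1) p.2) =
      M.tp (σ := fun p : Fin n × X => σ p.2) (fun p => a (j p.1) p.2)

end Str

/-- h-inductive sentences `∀ x (φ(x) → ψ(x))`, with `x` a finite tuple of variables. -/
structure HSentence (L : Signature S) where
  n : ℕ
  sorts : Fin n → S
  premise : Formula L sorts
  conclusion : Formula L sorts

/-- Truth of an h-inductive sentence. -/
def Str.Satisfies {L : Signature S} (M : Str L) (χ : HSentence L) : Prop :=
  ∀ a : M.Tuple χ.sorts, M.Realize χ.premise a → M.Realize χ.conclusion a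

/-- A (positive) theory is a set of h-inductive sentences. -/
abbrev Theory (L : Signature S) := Set (HSentence L)

/-- `M` is a model of `T`. -/
def Str.Models {L : Signature S} (M : Str L) (T : Theory L) : Prop := ∀ χ ∈ T, M.Satisfies χ

/-- The set of all h-inductive sentences true in `M`. -/
def Str.theory {L : Signature S} (M : Str L) : Theory L := {χ | M.Satisfies χ}

namespace Theory

variable {L : Signature S} (T : Theory L)

/-- Joint embedding property: for positive existential sentences, `T ⊨ ¬φ ∨ ¬ψ` implies `T ⊨ ¬φ`
or `T ⊨ ¬ψ`. -/
def JEP : Prop :=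
  ∀ φ ψ : Formula L (Empty.elim : Empty → S),
    (∀ N : Str L, N.Models T → ¬ N.Realize φ (fun x => x.elim) ∨ ¬ N.Realize ψ (fun x => x.elim)) →
    (∀ N : Str L, N.Models T → ¬ N.Realize φ (fun x => x.elim)) ∨
      ∀ N : Str L, N.Models T → ¬ N.Realize ψ (fun x => x.elim)

/-- `M` is an existentially closed model of `T`: whenever `M ⊭ φ(a)` there is `ψ(x)` with
`T ⊨ ¬∃x (φ(x) ∧ ψ(x))` and `M ⊨ ψ(a)`. -/
def IsEC (M : Str L) : Prop :=
  M.Models T ∧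
  ∀ (X : Type u) (σ : X → S) (φ : Formula L σ) (a : M.Tuple σ), ¬ M.Realize φ a →
    ∃ ψ : Formula L σ, M.Realize ψ a ∧
      ∀ N : Str L, N.Models T → ∀ b : N.Tuple σ, ¬ (N.Realize φ b ∧ N.Realize ψ b)

/-- `M` is a monster model of `T`, where "small" means of cardinality less than `κ`. -/
structure IsMonster (κ : Cardinal.{u}) (M : Str L) : Prop where
  /-- `M` is an e.c. model of `T` -/
  ec : T.IsEC M
  /-- partial immersions `a ↦ b` between small sets extend to automorphisms -/
  homogeneous : ∀ (X : Type u) (σ : X → S), #X < κ → ∀ a b : M.Tuple σ, M.tp a = M.tp b →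
    ∃ f : ∀ s, M.carrier s ≃ M.carrier s, M.IsAutomorphism f ∧ ∀ x, f _ (a x) = b x
  /-- a finitely satisfiable small set of formulas `φ(x, m)`, with parameters in `M`, is
  satisfiable -/
  saturated : ∀ (X : Type u) (σ : X → S), #X < κ →
    ∀ Φ : Set (Formula L (Sum.elim σ (Sigma.fst : (Σ s, M.carrier s) → S))), #Φ < κ →
      (∀ Φ₀ ⊆ Φ, Φ₀.Finite → ∃ a : M.Tuple σ, M.RealizeSet Φ₀ (M.append a Sigma.snd)) →
      ∃ a : M.Tuple σ, M.RealizeSet Φ (M.append a Sigma.snd)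

/-- A set of formulas is consistent with `T` if it is realised in some model of `T`. -/
def Consistent {X : Type u} {σ : X → S} (p : Set (Formula L σ)) : Prop :=
  ∃ N : Str L, N.Models T ∧ ∃ a : N.Tuple σ, N.RealizeSet p a

/-- A type in `T` is a maximal set of formulas consistent with `T`. -/
def IsType {X : Type u} {σ : X → S} (p : Set (Formula L σ)) : Prop :=
  Maximal T.Consistent p

/-- `T`, with monster model `M`, is Hausdorff: distinct types `p(x)`, `q(x)` in a small tuple of
variables admit `φ ∉ p` and `ψ ∉ q` with `M ⊨ ∀ x (φ(x) ∨ ψ(x))`. -/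
def IsHausdorff (κ : Cardinal.{u}) (M : Str L) : Prop :=
  ∀ (X : Type u) (σ : X → S), #X < κ → ∀ p q : Set (Formula L σ), T.IsType p → T.IsType q → p ≠ q →
    ∃ φ ψ : Formula L σ, φ ∉ p ∧ ψ ∉ q ∧ ∀ a : M.Tuple σ, M.Realize φ a ∨ M.Realize ψ a

/-- A partial type in `T` is a set of formulas consistent with `T`. The theory `T`, with monster
model `M`, is semi-Hausdorff: equality of types of small tuples is defined by a partial type. -/
def IsSemiHausdorff (κ : Cardinal.{u}) (M : Str L) : Prop :=
  ∀ (X : Type u) (σ : X → S), #X < κ → ∃ Ω : Set (Formula L (Sum.elim σ σ)), T.Consistent Ω ∧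
    ∀ a b : M.Tuple σ, M.tp a = M.tp b ↔ M.RealizeSet Ω (M.append a b)

/-- `T`, with monster model `M`, is thick: indiscernibility of an `ω`-sequence of small tuples is
defined by a partial type. -/
def IsThick (κ : Cardinal.{u}) (M : Str L) : Prop :=
  ∀ (X : Type u) (σ : X → S), #X < κ →
    ∃ Θ : Set (Formula L (fun p : ℕ × X => σ p.2)), T.Consistent Θ ∧
      ∀ a : ℕ → M.Tuple σ, M.Indiscernible a ↔ M.RealizeSet Θ (fun p => a p.1 p.2)

end Theory

/-! ### Hyperimaginaries -/

/-- A signature with exactly one sort. -/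
abbrev OneSorted := Signature PUnit.{u + 1}

/-- A family `𝓔` of sets of formulas `E(x, y)` (over `∅`), where `x` and `y` are tuples of variables
of the same length. -/
structure HypFamily (L : OneSorted.{u}) where
  /-- the index set of the family -/
  Idx : Type u
  /-- the index set of the tuples `x` and `y` in `E(x, y)` -/
  Len : Idx → Type u
  /-- the set of formulas `E(x, y)` -/
  E : ∀ e : Idx, Set (Formula L (fun _ : Len e ⊕ Len e => PUnit.unit))

/-- The sorts of the hyperimaginary language. -/
inductive HypSort (ι : Type u) : Type u
  | real : HypSort ι
  | hyp (e : ι) : HypSort ι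

namespace HypFamily

variable {L : OneSorted.{u}} (H : HypFamily L)

/-- The relation on tuples of elements of `M` defined by `E(x, y)`. -/
def Related (M : Str L) (e : H.Idx) (a b : H.Len e → M.carrier PUnit.unit) : Prop :=
  M.RealizeSet (H.E e) (Sum.elim a b)

/-- Every member of the family defines an equivalence relation in `M`. -/
def IsEquiv (M : Str L) : Prop := ∀ e, Equivalence (H.Related M e)

/-- The added relation symbols `R_φ(x, y_1, …, y_m)`: one for each `L`-formula
`φ(x, y_{1,r}, …, y_{m,r})`, where `x` is an `n`-tuple of real variables, `y_j` is of sort `S_{E_j}`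
and `y_{j,r}` is a tuple of real variables as long as the tuples representing elements of
`S_{E_j}`. -/
structure NewRel where
  n : ℕ
  m : ℕ
  e : Fin m → H.Idx
  φ : Formula L (fun _ : Fin n ⊕ (Σ j : Fin m, H.Len (e j)) => PUnit.unit)

/-- The hyperimaginary language `L_𝓔`. -/
def lang : Signature (HypSort H.Idx) where
  Func := L.Func
  FuncArg := L.FuncArg
  finite_funcArg := L.finite_funcArg
  dom _ _ := .real
  cod _ := .real
  Rel := L.Rel ⊕ H.NewRel
  RelArg := Sum.elim L.RelArg fun R => Fin R.n ⊕ Fin R.m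
  finite_relArg
    | .inl R => L.finite_relArg R
    | .inr R => inferInstanceAs (Finite (Fin R.n ⊕ Fin R.m))
  rdom
    | .inl _ => fun _ => .real
    | .inr R => Sum.elim (fun _ => .real) fun j => .hyp (R.e j)

variable {H} {M : Str L} (hE : H.IsEquiv M)

/-- The setoid of `E`-equivalence on tuples. -/
def setoid (e : H.Idx) : Setoid (H.Len e → M.carrier PUnit.unit) := ⟨H.Related M e, hE e⟩

/-- The universe of `M^𝓔`: the real sort is `M`, and the sort `S_E` is `M / E`. -/
def hypCarrier : HypSort H.Idx → Type u
  | .real => M.carrier PUnit.unit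
  | .hyp e => Quotient (setoid hE e)

/-- The `L_𝓔`-structure `M^𝓔`: symbols of `L` are interpreted as in `M`, and `R_φ(a, c_1, …, c_m)`
holds iff `M ⊨ φ(a, b_1, …, b_m)` for some representatives `b_j` of `c_j`. -/
def str : Str H.lang where
  carrier := hypCarrier hE
  func f a := M.func f a
  rel
    | .inl R => fun a => M.rel R a
    | .inr R => fun c => ∃ b : ∀ j : Fin R.m, H.Len (R.e j) → M.carrier PUnit.unit,
        (∀ j, (Quotient.mk (setoid hE (R.e j)) (b j) : hypCarrier hE (.hyp (R.e j)))
          = c (Sum.inr j)) ∧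
        M.Realize R.φ (Sum.elim (fun i => c (Sum.inl i)) fun z => b z.1 z.2)

/-- The hyperimaginary extension `T^𝓔`: all h-inductive `L_𝓔`-sentences true in `M^𝓔`. -/
def extension : Theory H.lang := (str hE).theory

end HypFamily

end PosLogic

/-! The proof passes between `M` and `M^𝓔` by choosing real representatives for hyperimaginary
tuples. Two translations carry it. An `L_𝓔`-formula defines a type-definable set of representatives
(`typeDefinable_bRealize`): existential quantifiers commute with the conjunctions that arise, by
saturation. Conversely, for an `L`-formula `ψ`, "some representatives satisfy `ψ`" is expressed by a
symbol `R_φ` (`exists_repFormula`). Combined with compactness, if a hyperimaginary tuple satisfies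
every `L_𝓔`-formula valid on a set `K` whose members all have representatives realising a partial
type `Φ`, then it too has representatives realising `Φ` (`exists_rep_realizeSet`). In particular,
equality of types lifts to representatives (`exists_rep_tp_eq`).

Hausdorff: representatives of realisations of distinct types `p`, `q` form type-definable sets, any
two members of which are separated in `T`. Compactness, used once for each set, yields one pair of
separating formulas, which is then translated to `L_𝓔`.

Semi-Hausdorff and thick: the new partial type consists of all `L_𝓔`-formulas valid on pairs of
equal type, respectively on indiscernible sequences. A realisation has representatives satisfying
the partial type given by `T`, hence has the desired property. For this, members of the defining
class must themselves have good representatives. For pairs this is the lifting of types; for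
sequences it is `exists_indiscernible_rep`, which rests on an Erdős–Rado extraction.
Indiscernibility is checked on finite subtuples, whose representatives have length at most `μ`, so
that there are few formulas to use as colours. All that is needed from the size of `κ` is a strong
limit cardinal `B` with `μ < B ≤ κ`. -/

namespace PosLogic

/-! ### Substitution, finite connectives and finite support of formulas -/

section Substitution

variable {S : Type u} {L : Signature S}

/-- Simultaneous substitution of terms for variables in a term. -/
def Term.subst {X : Type*} {X' : Type*} {σ : X → S} {σ' : X' → S}
    (g : ∀ x, Term L σ' (σ x)) : {s : S} → Term L σ s → Term L σ' s
  | _, .var x => g x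
  | _, .app f ts => .app f fun i => (ts i).subst g

theorem Str.eval_subst (M : Str L) {X : Type*} {X' : Type*} {σ : X → S} {σ' : X' → S}
    (g : ∀ x, Term L σ' (σ x)) (v : M.Tuple σ') {s : S} (t : Term L σ s) :
    M.eval v (t.subst g) = M.eval (fun x => M.eval v (g x)) t := by
  induction t with
  | var x => rfl
  | app f ts ih => simp only [Term.subst, Str.eval, ih]

/-- Weakening of a term by a new bound variable. -/
def Term.weaken {X : Type*} {σ : X → S} {Γ : List S} (s : S) {r : S} (t : Term L (ctx σ Γ) r) :
    Term L (ctx σ (s :: Γ)) r :=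
  t.subst fun
    | .inl x => .var (σ := ctx σ (s :: Γ)) (.inl x)
    | .inr k => .var (σ := ctx σ (s :: Γ)) (.inr k.succ)

theorem Str.eval_weaken (M : Str L) {X : Type*} {σ : X → S} {Γ : List S} {s r : S}
    (t : Term L (ctx σ Γ) r) (v : M.Tuple σ) (xs : M.Tuple Γ.get) (c : M.carrier s) :
    M.eval (M.append v (Fin.cons (α := fun i => M.carrier ((s :: Γ).get i)) c xs)) (t.weaken s)
      = M.eval (M.append v xs) t := by
  rw [Term.weaken, Str.eval_subst]
  congr 1
  funext x
  rcases x with x | x <;> rfl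

/-- Lifting of a substitution under a quantifier. -/
def liftSubst {X : Type*} {X' : Type*} {σ : X → S} {σ' : X' → S} {Γ Γ' : List S} (s : S)
    (g : ∀ v, Term L (ctx σ' Γ') (ctx σ Γ v)) :
    ∀ v, Term L (ctx σ' (s :: Γ')) (ctx σ (s :: Γ) v)
  | .inl x => (g (.inl x)).weaken s
  | .inr ⟨0, _⟩ => .var (σ := ctx σ' (s :: Γ')) (.inr 0)
  | .inr ⟨k + 1, h⟩ => (g (.inr ⟨k, Nat.lt_of_succ_lt_succ h⟩)).weaken s

/-- Simultaneous substitution of terms for the free and bound variables of a formula. -/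
def BFormula.subst {X : Type*} {X' : Type*} {σ : X → S} {σ' : X' → S} :
    {Γ Γ' : List S} → (∀ v, Term L (ctx σ' Γ') (ctx σ Γ v)) → BFormula L σ Γ → BFormula L σ' Γ'
  | _, _, _, .top => .top
  | _, _, _, .bot => .bot
  | _, _, g, .equal t₁ t₂ => .equal (t₁.subst g) (t₂.subst g)
  | _, _, g, .rel R ts => .rel R fun i => (ts i).subst g
  | _, _, g, .and φ ψ => .and (φ.subst g) (ψ.subst g)
  | _, _, g, .or φ ψ => .or (φ.subst g) (ψ.subst g)
  | _, _, g, .ex s φ => .ex s (φ.subst (liftSubst s g))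

theorem Str.bRealize_subst (M : Str L) {X : Type*} {X' : Type*} {σ : X → S} {σ' : X' → S}
    {Γ Γ' : List S} (g : ∀ v, Term L (ctx σ' Γ') (ctx σ Γ v)) (φ : BFormula L σ Γ)
    (a : M.Tuple σ) (a' : M.Tuple σ') (xs : M.Tuple Γ.get) (xs' : M.Tuple Γ'.get)
    (h : ∀ v, M.eval (M.append a' xs') (g v) = M.append a xs v) :
    M.BRealize a' (φ.subst g) xs' ↔ M.BRealize a φ xs := by
  induction φ generalizing Γ' with
  | top => rfl
  | bot => rfl
  | equal t₁ t₂ =>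
    simp only [BFormula.subst, Str.BRealize, Str.eval_subst, funext h]
  | rel R ts =>
    simp only [BFormula.subst, Str.BRealize, Str.eval_subst, funext h]
  | and φ ψ ih₁ ih₂ =>
    simp only [BFormula.subst, Str.BRealize, ih₁ g xs xs' h, ih₂ g xs xs' h]
  | or φ ψ ih₁ ih₂ =>
    simp only [BFormula.subst, Str.BRealize, ih₁ g xs xs' h, ih₂ g xs xs' h]
  | ex s φ ih =>
    simp only [BFormula.subst, Str.BRealize]
    refine exists_congr fun c => ih _ _ _ ?_
    rintro (x | ⟨_ | k, hk⟩)
    · exact (M.eval_weaken _ _ _ _).trans (h _)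
    · rfl
    · exact (M.eval_weaken _ _ _ _).trans (h (.inr ⟨k, Nat.lt_of_succ_lt_succ hk⟩))

/-- A substitution for the free variables of a formula without bound ones. -/
def substFree {X : Type*} {X' : Type*} {σ : X → S} {σ' : X' → S} {Γ' : List S}
    (g : ∀ x, Term L (ctx σ' Γ') (σ x)) : ∀ v, Term L (ctx σ' Γ') (ctx σ [] v)
  | .inl x => g x
  | .inr k => k.elim0

theorem Str.bRealize_substFree (M : Str L) {X : Type*} {X' : Type*} {σ : X → S} {σ' : X' → S}
    {Γ' : List S} (g : ∀ x, Term L (ctx σ' Γ') (σ x)) (φ : Formula L σ)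
    (a' : M.Tuple σ') (xs' : M.Tuple Γ'.get) :
    M.BRealize a' (φ.subst (substFree g)) xs' ↔
      M.Realize φ (fun x => M.eval (M.append a' xs') (g x)) := by
  apply M.bRealize_subst
  rintro (x | k)
  · rfl
  · exact k.elim0

/-- A term without bound variables as a term in a context. -/
def Term.inCtx {X : Type*} {σ : X → S} {Γ : List S} {s : S} (t : Term L σ s) :
    Term L (ctx σ Γ) s :=
  t.subst (σ := σ) (σ' := ctx σ Γ) fun x => .var (σ := ctx σ Γ) (.inl x)

theorem Str.eval_inCtx (M : Str L) {X : Type*} {σ : X → S} {Γ : List S} {s : S} (t : Term L σ s)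
    (a : M.Tuple σ) (xs : M.Tuple Γ.get) : M.eval (M.append a xs) t.inCtx = M.eval a t := by
  exact M.eval_subst (σ := σ) (σ' := ctx σ Γ) (fun x => .var (σ := ctx σ Γ) (.inl x)) _ t

/-- Substitution of terms for the variables of a formula. -/
def Formula.subst {X : Type*} {X' : Type*} {σ : X → S} {σ' : X' → S}
    (g : ∀ x, Term L σ' (σ x)) (φ : Formula L σ) : Formula L σ' :=
  BFormula.subst (substFree fun x => (g x).inCtx) φ

theorem Str.realize_subst (M : Str L) {X : Type*} {X' : Type*} {σ : X → S} {σ' : X' → S}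
    (g : ∀ x, Term L σ' (σ x)) (φ : Formula L σ) (a : M.Tuple σ') :
    M.Realize (Formula.subst g φ) a ↔ M.Realize φ (fun x => M.eval a (g x)) := by
  rw [Formula.subst, Str.Realize, Str.bRealize_substFree]
  simp only [Str.eval_inCtx]

/-- Renaming of the variables of a formula. -/
def Formula.rename {X : Type*} {X' : Type*} {σ' : X' → S}
    (f : X → X') (φ : Formula L (fun x => σ' (f x))) : Formula L σ' :=
  Formula.subst (fun x => .var (f x)) φ

theorem Str.realize_rename (M : Str L) {X : Type*} {X' : Type*} {σ' : X' → S}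
    (f : X → X') (φ : Formula L (fun x => σ' (f x))) (a : M.Tuple σ') :
    M.Realize (Formula.rename f φ) a ↔ M.Realize φ (fun x => a (f x)) :=
  M.realize_subst _ _ _

/-- Conjunction of a list of formulas. -/
def conj {X : Type*} {σ : X → S} : List (Formula L σ) → Formula L σ
  | [] => .top
  | φ :: l => .and φ (conj l)

theorem Str.realize_conj (M : Str L) {X : Type*} {σ : X → S} (l : List (Formula L σ))
    (a : M.Tuple σ) : M.Realize (conj l) a ↔ ∀ φ ∈ l, M.Realize φ a := by
  induction l with
  | nil => simp [conj, Str.Realize, Str.BRealize]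
  | cons φ l ih =>
    rw [List.forall_mem_cons, ← ih]
    rfl

/-- Disjunction of a list of formulas. -/
def disj {X : Type*} {σ : X → S} : List (Formula L σ) → Formula L σ
  | [] => .bot
  | φ :: l => .or φ (disj l)

theorem Str.realize_disj (M : Str L) {X : Type*} {σ : X → S} (l : List (Formula L σ))
    (a : M.Tuple σ) : M.Realize (disj l) a ↔ ∃ φ ∈ l, M.Realize φ a := by
  induction l with
  | nil => simp [disj, Str.Realize, Str.BRealize]
  | cons φ l ih =>
    rw [List.exists_mem_cons_iff, ← ih]
    rfl

/-- Existential quantification over all bound variables. -/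
def exAll {X : Type*} {σ : X → S} : (Γ : List S) → BFormula L σ Γ → Formula L σ
  | [], φ => φ
  | s :: Γ, φ => exAll Γ (.ex s φ)

theorem Str.realize_exAll (M : Str L) {X : Type*} {σ : X → S} (Γ : List S) (φ : BFormula L σ Γ)
    (a : M.Tuple σ) : M.Realize (exAll Γ φ) a ↔ ∃ xs : M.Tuple Γ.get, M.BRealize a φ xs := by
  induction Γ with
  | nil =>
    refine ⟨fun h => ⟨_, h⟩, fun ⟨xs, h⟩ => ?_⟩
    have : xs = fun i => i.elim0 := funext fun i => i.elim0
    subst this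
    exact h
  | cons s Γ ih =>
    rw [exAll, ih]
    constructor
    · rintro ⟨xs, c, h⟩
      exact ⟨_, h⟩
    · rintro ⟨xs, h⟩
      refine ⟨fun i => xs i.succ, xs 0, ?_⟩
      convert h
      funext i
      rcases i with ⟨_ | k, hk⟩ <;> rfl

theorem Term.exists_finite_support {X : Type*} {σ : X → S} {Γ : List S} {s : S}
    (t : Term L (ctx σ Γ) s) : ∃ A : Set X, A.Finite ∧ ∀ {Z : Type w} (f : Z → X),
      A ⊆ Set.range f → ∃ t' : Term L (ctx (fun z => σ (f z)) Γ) s, ∀ (M : Str L)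
        (a : M.Tuple σ) (xs : M.Tuple Γ.get),
        M.eval (M.append (fun z => a (f z)) xs) t' = M.eval (M.append a xs) t := by
  induction t with
  | var x =>
    rcases x with x | k
    · refine ⟨{x}, Set.finite_singleton x, fun f hf => ?_⟩
      obtain ⟨z, rfl⟩ := hf rfl
      exact ⟨.var (σ := ctx (fun z => σ (f z)) Γ) (.inl z), fun _ _ _ => rfl⟩
    · exact ⟨∅, Set.finite_empty, fun f _ =>
        ⟨.var (σ := ctx (fun z => σ (f z)) Γ) (.inr k), fun _ _ _ => rfl⟩⟩
  | app f ts ih =>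
    choose A hA h using ih
    have := L.finite_funcArg f
    refine ⟨⋃ i, A i, Set.finite_iUnion hA, fun f' hf => ?_⟩
    choose t' ht' using fun i => h i f' ((Set.subset_iUnion A i).trans hf)
    refine ⟨.app f t', fun M a xs => ?_⟩
    simp only [Str.eval, ht']

theorem BFormula.exists_finite_support {X : Type*} {σ : X → S} {Γ : List S}
    (φ : BFormula L σ Γ) : ∃ A : Set X, A.Finite ∧ ∀ {Z : Type w} (f : Z → X),
      A ⊆ Set.range f → ∃ φ' : BFormula L (fun z => σ (f z)) Γ, ∀ (M : Str L)
        (a : M.Tuple σ) (xs : M.Tuple Γ.get),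
        M.BRealize (fun z => a (f z)) φ' xs ↔ M.BRealize a φ xs := by
  induction φ with
  | top => exact ⟨∅, Set.finite_empty, fun _ _ => ⟨.top, fun _ _ _ => Iff.rfl⟩⟩
  | bot => exact ⟨∅, Set.finite_empty, fun _ _ => ⟨.bot, fun _ _ _ => Iff.rfl⟩⟩
  | equal t₁ t₂ =>
    obtain ⟨A₁, f₁, h₁⟩ := t₁.exists_finite_support
    obtain ⟨A₂, f₂, h₂⟩ := t₂.exists_finite_support
    refine ⟨A₁ ∪ A₂, f₁.union f₂, fun f hf => ?_⟩
    obtain ⟨t₁', e₁⟩ := h₁ f (Set.subset_union_left.trans hf)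
    obtain ⟨t₂', e₂⟩ := h₂ f (Set.subset_union_right.trans hf)
    exact ⟨.equal t₁' t₂', fun M a xs => by simp only [Str.BRealize, e₁, e₂]⟩
  | rel R ts =>
    choose A hA h using fun i => (ts i).exists_finite_support
    have := L.finite_relArg R
    refine ⟨⋃ i, A i, Set.finite_iUnion hA, fun f hf => ?_⟩
    choose t' ht' using fun i => h i f ((Set.subset_iUnion A i).trans hf)
    exact ⟨.rel R t', fun M a xs => by simp only [Str.BRealize, ht']⟩
  | and φ ψ ih₁ ih₂ =>
    obtain ⟨A₁, f₁, h₁⟩ := ih₁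
    obtain ⟨A₂, f₂, h₂⟩ := ih₂
    refine ⟨A₁ ∪ A₂, f₁.union f₂, fun f hf => ?_⟩
    obtain ⟨φ', e₁⟩ := h₁ f (Set.subset_union_left.trans hf)
    obtain ⟨ψ', e₂⟩ := h₂ f (Set.subset_union_right.trans hf)
    exact ⟨.and φ' ψ', fun M a xs => by simp only [Str.BRealize, e₁, e₂]⟩
  | or φ ψ ih₁ ih₂ =>
    obtain ⟨A₁, f₁, h₁⟩ := ih₁
    obtain ⟨A₂, f₂, h₂⟩ := ih₂
    refine ⟨A₁ ∪ A₂, f₁.union f₂, fun f hf => ?_⟩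
    obtain ⟨φ', e₁⟩ := h₁ f (Set.subset_union_left.trans hf)
    obtain ⟨ψ', e₂⟩ := h₂ f (Set.subset_union_right.trans hf)
    exact ⟨.or φ' ψ', fun M a xs => by simp only [Str.BRealize, e₁, e₂]⟩
  | ex s φ ih =>
    obtain ⟨A, hA, h⟩ := ih
    refine ⟨A, hA, fun f hf => ?_⟩
    obtain ⟨φ', e⟩ := h f hf
    exact ⟨.ex s φ', fun M a xs => by simp only [Str.BRealize, e]⟩

/-- A formula involves finitely many variables: it is equivalent to one in the variables `Z`, for
every map `f : Z → X` whose range contains a certain finite set. -/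
theorem Formula.exists_finite_support {X : Type*} {σ : X → S} (φ : Formula L σ) :
    ∃ A : Set X, A.Finite ∧ ∀ {Z : Type w} (f : Z → X), A ⊆ Set.range f →
      ∃ φ' : Formula L (fun z => σ (f z)), ∀ (M : Str L) (a : M.Tuple σ),
        M.Realize φ' (fun z => a (f z)) ↔ M.Realize φ a := by
  obtain ⟨A, hA, h⟩ := BFormula.exists_finite_support φ
  refine ⟨A, hA, fun f hf => ?_⟩
  obtain ⟨φ', e⟩ := h f hf
  exact ⟨φ', fun M a => e M a _⟩

end Substitution


/-! ### Counting formulas by their syntax trees -/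

section Counting

variable {S : Type u} {L : Signature S}

/-- Labels of the nodes of the syntax tree of a formula: variables, function symbols, relation
symbols, quantifiers, logical constants and binary symbols (equality and connectives). -/
abbrev NodeLabel (L : Signature S) (X : Type u) : Type u :=
  (X ⊕ ℕ) ⊕ L.Func ⊕ L.Rel ⊕ S ⊕ Bool ⊕ Fin 3

/-- The children of a node of a syntax tree. -/
abbrev NodeArity (L : Signature S) (X : Type u) : NodeLabel L X → Type
  | .inl _ => Empty
  | .inr (.inl f) => L.FuncArg f
  | .inr (.inr (.inl R)) => L.RelArg R
  | .inr (.inr (.inr (.inl _))) => Unit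
  | .inr (.inr (.inr (.inr (.inl _)))) => Empty
  | .inr (.inr (.inr (.inr (.inr _)))) => Bool

instance finite_nodeArity (X : Type u) (n : NodeLabel L X) : Finite (NodeArity L X n) := by
  rcases n with _ | f | R | _ | _ | _
  · exact inferInstanceAs (Finite Empty)
  · exact L.finite_funcArg f
  · exact L.finite_relArg R
  · exact inferInstanceAs (Finite Unit)
  · exact inferInstanceAs (Finite Empty)
  · exact inferInstanceAs (Finite Bool)

/-- The syntax tree of a term. -/
def Term.tree {X : Type u} {V : Type u} {σ : V → S} (ι : V → X ⊕ ℕ) :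
    {s : S} → Term L σ s → WType (NodeArity L X)
  | _, .var x => ⟨.inl (ι x), fun i => i.elim⟩
  | _, .app f ts => ⟨.inr (.inl f), fun i => (ts i).tree ι⟩

/-- The sorts may differ a priori because an equation does not display the common sort of its two
sides; the tree has to recover it. -/
theorem Term.tree_injective {X : Type u} {V : Type u} {σ : V → S} {ι : V → X ⊕ ℕ}
    (hι : ι.Injective) {s s' : S} (t : Term L σ s)
    (t' : Term L σ s') (h : t.tree ι = t'.tree ι) :
    (⟨s, t⟩ : Σ s, Term L σ s) = ⟨s', t'⟩ := by
  induction t generalizing s' with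
  | var x =>
    cases t' with
    | var y =>
      have := hι (Sum.inl.inj (WType.mk.inj h).1)
      rw [this]
    | app f ts => exact nomatch (WType.mk.inj h).1
  | app f ts ih =>
    cases t' with
    | var y => exact nomatch (WType.mk.inj h).1
    | app f' ts' =>
      obtain ⟨h₁, h₂⟩ := WType.mk.inj h
      obtain rfl := Sum.inl.inj (Sum.inr.inj h₁)
      have : ts = ts' := funext fun i =>
        eq_of_heq (Sigma.mk.inj (ih i (ts' i) (congrFun (eq_of_heq h₂) i))).2
      rw [this]

/-- The position of a variable in a syntax tree. -/
def varNode {X : Type u} (n : ℕ) : X ⊕ Fin n → X ⊕ ℕ := Sum.map id Fin.val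

theorem varNode_injective {X : Type u} (n : ℕ) : (varNode (X := X) n).Injective :=
  Function.Injective.sumMap Function.injective_id Fin.val_injective

/-- The syntax tree of a formula. -/
def BFormula.tree {X : Type u} {σ : X → S} :
    {Γ : List S} → BFormula L σ Γ → WType (NodeArity L X)
  | _, .top => ⟨.inr (.inr (.inr (.inr (.inl true)))), fun i => i.elim⟩
  | _, .bot => ⟨.inr (.inr (.inr (.inr (.inl false)))), fun i => i.elim⟩
  | _, .equal t₁ t₂ => ⟨.inr (.inr (.inr (.inr (.inr 0)))),
      fun i => cond i (t₁.tree (varNode _)) (t₂.tree (varNode _))⟩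
  | _, .rel R ts => ⟨.inr (.inr (.inl R)), fun i => (ts i).tree (varNode _)⟩
  | _, .and φ ψ => ⟨.inr (.inr (.inr (.inr (.inr 1)))), fun i => cond i φ.tree ψ.tree⟩
  | _, .or φ ψ => ⟨.inr (.inr (.inr (.inr (.inr 2)))), fun i => cond i φ.tree ψ.tree⟩
  | _, .ex s φ => ⟨.inr (.inr (.inr (.inl s))), fun _ => φ.tree⟩

theorem BFormula.tree_injective {X : Type u} {σ : X → S} {Γ : List S} (φ ψ : BFormula L σ Γ)
    (h : φ.tree = ψ.tree) : φ = ψ := by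
  induction φ with
  | top => cases ψ <;> first | rfl | exact nomatch (WType.mk.inj h).1
  | bot => cases ψ <;> first | rfl | exact nomatch (WType.mk.inj h).1
  | equal t₁ t₂ =>
    cases ψ with
    | equal t₁' t₂' =>
      have h₂ := eq_of_heq (WType.mk.inj h).2
      have e₁ := Term.tree_injective (varNode_injective _) t₁ t₁' (congrFun h₂ true)
      have e₂ := Term.tree_injective (varNode_injective _) t₂ t₂' (congrFun h₂ false)
      obtain ⟨rfl, e₁⟩ := Sigma.mk.inj e₁
      obtain rfl := eq_of_heq e₁
      obtain rfl := eq_of_heq (Sigma.mk.inj e₂).2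
      rfl
    | _ => exact nomatch (WType.mk.inj h).1
  | rel R ts =>
    cases ψ with
    | rel R' ts' =>
      obtain ⟨h₁, h₂⟩ := WType.mk.inj h
      obtain rfl := Sum.inl.inj (Sum.inr.inj (Sum.inr.inj h₁))
      have : ts = ts' := funext fun i => eq_of_heq (Sigma.mk.inj
        (Term.tree_injective (varNode_injective _) _ _ (congrFun (eq_of_heq h₂) i))).2
      rw [this]
    | _ => exact nomatch (WType.mk.inj h).1
  | and φ₁ φ₂ ih₁ ih₂ =>
    cases ψ with
    | and ψ₁ ψ₂ =>
      have h₂ := eq_of_heq (WType.mk.inj h).2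
      rw [ih₁ ψ₁ (congrFun h₂ true), ih₂ ψ₂ (congrFun h₂ false)]
    | _ => exact nomatch (WType.mk.inj h).1
  | or φ₁ φ₂ ih₁ ih₂ =>
    cases ψ with
    | or ψ₁ ψ₂ =>
      have h₂ := eq_of_heq (WType.mk.inj h).2
      rw [ih₁ ψ₁ (congrFun h₂ true), ih₂ ψ₂ (congrFun h₂ false)]
    | _ => exact nomatch (WType.mk.inj h).1
  | ex s φ ih =>
    cases ψ with
    | ex s' φ' =>
      obtain ⟨h₁, h₂⟩ := WType.mk.inj h
      obtain rfl := Sum.inl.inj (Sum.inr.inj (Sum.inr.inj (Sum.inr.inj h₁)))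
      rw [ih φ' (congrFun (eq_of_heq h₂) ())]
    | _ => exact nomatch (WType.mk.inj h).1

/-- The number of formulas is bounded by the number of symbols, sorts and variables. -/
theorem mk_formula_le {X : Type u} (σ : X → S) {ν : Cardinal.{u}} (hν : ℵ₀ ≤ ν) (hX : #X ≤ ν)
    (hF : #L.Func ≤ ν) (hR : #L.Rel ≤ ν) (hS : #S ≤ ν) : #(Formula L σ) ≤ ν := by
  refine (Cardinal.mk_le_of_injective (f := BFormula.tree) BFormula.tree_injective).trans
    (WType.cardinalMk_le_max_aleph0_of_finite'.trans (max_le ?_ hν))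
  have h₁ : lift.{u} #ℕ ≤ ν := by simpa using hν
  have h₂ : lift.{u} #Bool ≤ ν := by simpa using (natCast_lt_aleph0 (n := 2)).le.trans hν
  have h₃ : lift.{u} #(Fin 3) ≤ ν := by simpa using (natCast_lt_aleph0 (n := 3)).le.trans hν
  have := fun (a b : Cardinal.{u}) (ha : a ≤ ν) (hb : b ≤ ν) => add_le_of_le hν ha hb
  simp only [NodeLabel, mk_sum, lift_add, lift_id, lift_uzero]
  exact this _ _ (this _ _ hX h₁) (this _ _ hF (this _ _ hR (this _ _ hS (this _ _ h₂ h₃))))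

end Counting


/-! ### The Erdős–Rado theorem for finite exponents -/

section Partition

variable {I : Type u} [LinearOrder I] [WellFoundedLT I] {C : Type u} {n : ℕ}
  {Θ : Type u} [LinearOrder Θ] [WellFoundedLT Θ]

/-- Candidates for the next point of the branch below `x` of the Erdős–Rado tree of `f`, given the
points `b j`, `j < i`, of the branch. -/
def branchSet (f : (Fin n → I) → I → C) (x : I) (i : Θ) (b : ∀ j, j < i → I) : Set I :=
  {y | (∀ j hj, b j hj < y) ∧ ∀ (s : Fin n → Θ) (hs : ∀ k, s k < i),
    f (fun k => b (s k) (hs k)) y = f (fun k => b (s k) (hs k)) x}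

/-- The branch below `x` of the Erdős–Rado tree of `f`. It is constant once it reaches `x`. -/
noncomputable def branch (f : (Fin n → I) → I → C) (x : I) : Θ → I :=
  wellFounded_lt.fix fun i b =>
    -- Inserting `x` keeps the set nonempty and serves as the default value. Before the branch
    -- reaches `x`, the point `x` is itself a candidate, so the insertion changes nothing.
    wellFounded_lt.min (insert x (branchSet f x i b)) (Set.insert_nonempty _ _)

theorem branch_eq (f : (Fin n → I) → I → C) (x : I) (i : Θ) :
    branch f x i = wellFounded_lt.min (insert x (branchSet f x i fun j _ => branch f x j))
      (Set.insert_nonempty _ _) :=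
  wellFounded_lt.fix_eq _ _

theorem branch_mem (f : (Fin n → I) → I → C) (x : I) (i : Θ) (h : branch f x i ≠ x) :
    branch f x i ∈ branchSet f x i fun j _ => branch f x j := by
  have := wellFounded_lt.min_mem (insert x (branchSet f x i fun j _ => branch f x j))
    (Set.insert_nonempty _ _)
  rw [← branch_eq] at this
  exact this.resolve_left h

theorem branch_le (f : (Fin n → I) → I → C) (x : I) (i : Θ) : branch f x i ≤ x := by
  rw [branch_eq]
  exact not_lt.1 (wellFounded_lt.not_lt_min _ (Set.mem_insert _ _))

/-- The candidates at a stage depend on the endpoint only through the earlier branch points and the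
colours they form with the endpoint, so branches with the same colours coincide by induction. -/
theorem branch_eq_of_agree (f : (Fin n → I) → I → C) {x x' : I} {i : Θ}
    (h : ∀ j < i, branch f x j ≠ x) (h' : ∀ j < i, branch f x' j ≠ x')
    (hf : ∀ s : Fin n → Θ, f (fun k => branch f x (s k)) x = f (fun k => branch f x' (s k)) x')
    (j : Θ) (hj : j ≤ i) : branch f x j = branch f x' j := by
  induction j using WellFoundedLT.induction with
  | ind j ih =>
    have key : ∀ z : I, (∀ l < i, branch f z l ≠ z) →
        insert z (branchSet f z j fun l _ => branch f z l) =
          branchSet f z j fun l _ => branch f z l := by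
      refine fun z hz => Set.insert_eq_of_mem ⟨fun l hl => ?_, fun _ _ => rfl⟩
      exact (branch_le f z l).lt_of_ne (hz l (hl.trans_le hj))
    have hb : (branchSet f x j fun l _ => branch f x l)
        = branchSet f x' j fun l _ => branch f x' l := by
      have ih' : ∀ l < j, branch f x l = branch f x' l := fun l hl => ih l hl (hl.le.trans hj)
      ext y
      refine and_congr (forall₂_congr fun l hl => by simp only [ih' l hl])
        (forall₂_congr fun s hs => ?_)
      have : (fun k => branch f x (s k)) = fun k => branch f x' (s k) :=
        funext fun k => ih' _ (hs k)
      rw [hf s, this]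
    rw [branch_eq, branch_eq]
    congr 1
    rw [key x h, key x' h', hb]

/-- Large colourings have end-homogeneous branches. -/
theorem exists_endHomogeneous (f : (Fin n → I) → I → C)
    (hI : #(Θ × ((Fin n → Θ) → C)) < #I) :
    ∃ (x : I) (b : Θ → I), StrictMono b ∧ (∀ i, b i < x) ∧
      ∀ (s : Fin n → Θ) (i : Θ), (∀ k, s k < i) →
        f (fun k => b (s k)) (b i) = f (fun k => b (s k)) x := by
  by_contra hcon
  -- A branch that never reaches its endpoint would itself be end-homogeneous.
  have hreach : ∀ x : I, ∃ i : Θ, branch f x i = x := by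
    by_contra! hx
    obtain ⟨x, hx⟩ := hx
    exact hcon ⟨x, branch f x, fun j i hji => (branch_mem f x i (hx i)).1 j hji,
      fun i => (branch_le f x i).lt_of_ne (hx i),
      fun s i hs => (branch_mem f x i (hx i)).2 s hs⟩
  let r : I → Θ := fun x => wellFounded_lt.min {i : Θ | branch f x i = x} (hreach x)
  have hr : ∀ x, branch f x (r x) = x := fun x =>
    wellFounded_lt.min_mem {i : Θ | branch f x i = x} (hreach x)
  have hlt : ∀ x, ∀ j < r x, branch f x j ≠ x := fun x j hj he =>
    wellFounded_lt.not_lt_min {i : Θ | branch f x i = x} he hj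
  -- The stage at which the branch reaches `x`, together with the colours along the branch,
  -- determines `x`; this contradicts the size of `I`.
  refine hI.not_ge (mk_le_of_injective
    (f := fun x => (r x, fun s : Fin n → Θ => f (fun k => branch f x (s k)) x)) ?_)
  intro x x' h
  obtain ⟨h₁, h₂⟩ := Prod.mk.inj h
  have := branch_eq_of_agree f (hlt x) (h₁ ▸ hlt x') (congrFun h₂) (r x) le_rfl
  rwa [hr, h₁, hr] at this

/-- A form of the Erdős–Rado theorem: below a strong limit cardinal `B` there are well-orders that
contain homogeneous copies of any smaller well-order for all colourings of increasing `n`-tuples in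
fewer than `B` colours. -/
theorem exists_homogeneous {B : Cardinal.{u}} (hB : B.IsStrongLimit) (hB₀ : ℵ₀ < B) (C : Type u)
    (hC : #C < B) (Θ : Type u) [LinearOrder Θ] [WellFoundedLT Θ] (hΘ : #Θ < B) (n : ℕ) :
    ∃ (I : Type u) (_ : LinearOrder I) (_ : WellFoundedLT I), #I < B ∧
      ∀ f : (Fin n → I) → C, ∃ (b : Θ → I) (c : C), StrictMono b ∧
        ∀ s : Fin n → Θ, StrictMono s → f (fun k => b (s k)) = c := by
  induction n with
  | zero =>
    refine ⟨Θ, inferInstance, inferInstance, hΘ, fun f => ⟨id, f Fin.elim0, strictMono_id, ?_⟩⟩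
    intro s _
    congr 1
    funext k
    exact k.elim0
  | succ n ih =>
    obtain ⟨J, _, _, hJ, hf⟩ := ih
    have hlt : #(J × ((Fin n → J) → C)) < B := by
      have hν : max ℵ₀ (max #J #C) < B := max_lt hB₀ (max_lt hJ hC)
      generalize hν' : max ℵ₀ (max #J #C) = ν at hν
      have h₀ : ℵ₀ ≤ ν := hν' ▸ le_max_left _ _
      have h₁ : #J ≤ ν := hν' ▸ (le_max_left _ _).trans (le_max_right _ _)
      have h₂ : #C ≤ ν := hν' ▸ (le_max_right _ _).trans (le_max_right _ _)
      have h₃ : #(Fin n → J) ≤ ν := by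
        rw [mk_pi, prod_const]
        simpa using (power_le_power_right h₁).trans (power_nat_le h₀)
      refine lt_of_le_of_lt ?_ (hB.isStrongPrelimit hν)
      rw [mk_prod, lift_id, lift_id]
      refine mul_le_of_le (h₀.trans (cantor ν).le) (h₁.trans (cantor ν).le) ?_
      rw [← power_def, ← power_self_eq h₀]
      exact (power_le_power_right h₂).trans (power_le_power_left (aleph0_pos.trans_le h₀).ne' h₃)
    refine ⟨(Order.succ #(J × ((Fin n → J) → C))).ord.ToType, inferInstance, inferInstance, ?_,
      fun f => ?_⟩
    · rw [mk_ord_toType]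
      exact hB.isSuccLimit.succ_lt hlt
    -- Along an end-homogeneous branch the last argument can be replaced by the endpoint `x`. This
    -- leaves a colouring of `n`-tuples from `J`, to which the induction hypothesis applies.
    · obtain ⟨x, b, hb, -, h⟩ := exists_endHomogeneous (Θ := J)
        (fun (s : Fin n → (Order.succ #(J × ((Fin n → J) → C))).ord.ToType) y =>
          f (Fin.snoc (α := fun _ => (Order.succ #(J × ((Fin n → J) → C))).ord.ToType) s y))
        (by rw [mk_ord_toType]; exact Order.lt_succ _)
      obtain ⟨b', c, hb', h'⟩ := hf fun s => f (Fin.snoc (α := fun _ => _) (fun k => b (s k)) x)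
      refine ⟨b ∘ b', c, hb.comp hb', fun s hs => ?_⟩
      rw [← h' (fun k => s k.castSucc) (fun k l hkl => hs (Fin.castSucc_lt_castSucc_iff.2 hkl)),
        ← h (fun k => b' (s k.castSucc)) (b' (s (Fin.last n)))
          fun k => hb' (hs (Fin.castSucc_lt_last k))]
      congr 1
      funext k
      refine Fin.lastCases ?_ (fun k => ?_) k <;> simp

end Partition


/-! ### Type-definable sets and compactness -/

section TypeDefinable

variable {L : OneSorted.{u}} {M : Str L}

/-- Formulas of a one-sorted language in the variables `Y`. -/
abbrev RFormula (L : OneSorted.{u}) (Y : Type u) : Type u :=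
  Formula L (fun _ : Y => PUnit.unit)

/-- Tuples of elements of a one-sorted structure, indexed by `Y`. -/
abbrev RTuple (M : Str L) (Y : Type u) : Type u := Y → M.carrier PUnit.unit

/-- A set of tuples is type-definable (over `∅`) if it is defined by a set of formulas. -/
def TypeDefinable {Y : Type u} (D : Set (RTuple M Y)) : Prop :=
  ∃ Φ : Set (RFormula L Y), D = {a | M.RealizeSet Φ a}

theorem typeDefinable_formula {Y : Type u} (φ : RFormula L Y) :
    TypeDefinable {a : RTuple M Y | M.Realize φ a} :=
  ⟨{φ}, by ext a; simp [Str.RealizeSet]⟩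

theorem typeDefinable_realizeSet {Y : Type u} (Φ : Set (RFormula L Y)) :
    TypeDefinable {a : RTuple M Y | M.RealizeSet Φ a} := ⟨Φ, rfl⟩

theorem TypeDefinable.iInter {Y : Type u} {ι : Sort*} {D : ι → Set (RTuple M Y)}
    (hD : ∀ i, TypeDefinable (D i)) : TypeDefinable (⋂ i, D i) := by
  choose Φ hΦ using hD
  refine ⟨⋃ i, Φ i, ?_⟩
  ext a
  simp only [hΦ, Set.mem_iInter, Set.mem_ofPred_eq, Str.RealizeSet, Set.mem_iUnion]
  exact ⟨fun h φ ⟨i, hi⟩ => h i φ hi, fun h i φ hi => h φ ⟨i, hi⟩⟩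

theorem TypeDefinable.inter {Y : Type u} {D E : Set (RTuple M Y)}
    (hD : TypeDefinable D) (hE : TypeDefinable E) : TypeDefinable (D ∩ E) := by
  rw [Set.inter_eq_iInter]
  exact .iInter fun b => by cases b <;> assumption

theorem TypeDefinable.union {Y : Type u} {D E : Set (RTuple M Y)}
    (hD : TypeDefinable D) (hE : TypeDefinable E) : TypeDefinable (D ∪ E) := by
  obtain ⟨Φ, rfl⟩ := hD
  obtain ⟨Ψ, rfl⟩ := hE
  refine ⟨Set.image2 BFormula.or Φ Ψ, ?_⟩
  ext a
  constructor
  · rintro (h | h) _ ⟨φ, hφ, ψ, hψ, rfl⟩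
    · exact Or.inl (h φ hφ)
    · exact Or.inr (h ψ hψ)
  · intro h
    by_contra! hcon
    simp only [Set.mem_union, Set.mem_ofPred_eq, Str.RealizeSet, not_or, not_forall] at hcon
    obtain ⟨⟨φ, hφ, hφa⟩, ψ, hψ, hψa⟩ := hcon
    exact (h _ ⟨φ, hφ, ψ, hψ, rfl⟩).elim hφa hψa

theorem TypeDefinable.subst {Y Z : Type u} {D : Set (RTuple M Z)} (hD : TypeDefinable D)
    (g : Z → Term L (fun _ : Y => PUnit.unit) PUnit.unit) :
    TypeDefinable {a : RTuple M Y | (fun z => M.eval a (g z)) ∈ D} := by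
  obtain ⟨Φ, rfl⟩ := hD
  refine ⟨Formula.subst (σ := fun _ : Z => PUnit.unit) g '' Φ, ?_⟩
  ext a
  simp only [Set.mem_ofPred_eq, Str.RealizeSet, Set.forall_mem_image, Str.realize_subst]

theorem TypeDefinable.preimage {Y Z : Type u} {D : Set (RTuple M Z)} (hD : TypeDefinable D)
    (g : Z → Y) : TypeDefinable {a : RTuple M Y | (fun z => a (g z)) ∈ D} :=
  hD.subst fun z => .var (g z)

theorem TypeDefinable.mem_of_tp_subset {Y : Type u} {D : Set (RTuple M Y)} (hD : TypeDefinable D)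
    {a b : RTuple M Y}
    (h : M.tp (σ := fun _ : Y => PUnit.unit) a ⊆ M.tp (σ := fun _ : Y => PUnit.unit) b)
    (ha : a ∈ D) : b ∈ D := by
  obtain ⟨Φ, rfl⟩ := hD
  exact fun φ hφ => h (ha φ hφ)

/-- Only finitely many variables from `Z` occur in `φ`, so the possibly infinite quantifier reduces
to a finite string of `∃`. -/
theorem typeDefinable_exists_formula {Y Z : Type u} (φ : RFormula L (Y ⊕ Z)) :
    TypeDefinable {a : RTuple M Y | ∃ c : RTuple M Z, M.Realize φ (Sum.elim a c)} := by
  -- The variables not occurring in `φ` still need values. If `Z` is nonempty and `M` is empty,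
  -- there is no `c` at all and `⊥` defines the set.
  by_cases hne : ∀ _ : Z, Nonempty (M.carrier PUnit.unit)
  · obtain ⟨A, hA, h⟩ := Formula.exists_finite_support φ
    obtain ⟨φ', hφ'⟩ := h (Subtype.val : A → Y ⊕ Z) (by simp)
    have hfin : Finite {z : Z // Sum.inr z ∈ A} :=
      (hA.preimage Sum.inr_injective.injOn).to_subtype
    obtain ⟨n, ⟨e⟩⟩ := Finite.exists_equiv_fin {z : Z // Sum.inr z ∈ A}
    let Γ : List PUnit.{u + 1} := List.replicate n PUnit.unit
    have hΓ : n = Γ.length := by simp [Γ]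
    let g : ∀ x : A, Term L (ctx (fun _ : Y => PUnit.unit) Γ) PUnit.unit := fun x =>
      match x with
      | ⟨.inl y, _⟩ => .var (σ := ctx (fun _ : Y => PUnit.unit) Γ) (.inl y)
      | ⟨.inr z, hz⟩ => .var (σ := ctx (fun _ : Y => PUnit.unit) Γ) (.inr (Fin.cast hΓ (e ⟨z, hz⟩)))
    convert typeDefinable_formula (M := M)
      (exAll (σ := fun _ : Y => PUnit.unit) Γ (BFormula.subst (substFree g) φ')) using 1
    ext a
    simp only [Set.mem_ofPred_eq, Str.realize_exAll, Str.bRealize_substFree, ← hφ']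
    constructor
    · rintro ⟨c, hc⟩
      refine ⟨fun k => c (e.symm (Fin.cast hΓ.symm k)).1, ?_⟩
      convert hc using 1
      funext x
      rcases x with ⟨y | z, hx⟩
      · rfl
      · simp [g, Str.eval, Str.append]
    · rintro ⟨xs, hxs⟩
      classical
      refine ⟨fun z => if hz : Sum.inr z ∈ A then xs (Fin.cast hΓ (e ⟨z, hz⟩))
        else (hne z).some, ?_⟩
      convert hxs using 1
      funext x
      rcases x with ⟨y | z, hx⟩
      · rfl
      · simp [g, Str.eval, Str.append, hx]
  · push Not at hne
    obtain ⟨z, hz⟩ := hne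
    convert typeDefinable_formula (M := M) (Y := Y) .bot using 1
    ext a
    exact ⟨fun ⟨c, _⟩ => (hz.false (c z)).elim, fun h => h.elim⟩

/-- Saturation for sets of formulas with a small tuple of parameters. -/
def FiberCompact (κ : Cardinal.{u}) (M : Str L) : Prop :=
  ∀ (Y Z : Type u), #Y < κ → #Z < κ → ∀ (Φ : Set (RFormula L (Y ⊕ Z))) (a : RTuple M Y),
    (∀ Φ₀ ⊆ Φ, Φ₀.Finite → ∃ c : RTuple M Z, M.RealizeSet Φ₀ (Sum.elim a c)) →
      ∃ c : RTuple M Z, M.RealizeSet Φ (Sum.elim a c)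

variable {κ : Cardinal.{u}}

/-- No bound on `Φ` is required, since a small tuple of variables admits fewer than `κ` formulas
altogether. -/
theorem Theory.IsMonster.fiberCompact {T : Theory L} (hM : T.IsMonster κ M)
    (hsmall : ∀ Y : Type u, #Y < κ → #(RFormula L Y) < κ) (hκ : ℵ₀ ≤ κ) : FiberCompact κ M := by
  intro Y Z hY hZ Φ a h
  let ρ : Y ⊕ Z → Z ⊕ (Σ s, M.carrier s) := Sum.elim (fun y => .inr ⟨PUnit.unit, a y⟩) .inl
  let σ : Z ⊕ (Σ s, M.carrier s) → PUnit.{u + 1} := Sum.elim (fun _ => PUnit.unit) Sigma.fst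
  have key : ∀ (φ : RFormula L (Y ⊕ Z)) (c : RTuple M Z),
      M.Realize (Formula.rename (σ' := σ) ρ φ)
        (M.append (σ := fun _ : Z => PUnit.unit) c Sigma.snd) ↔ M.Realize φ (Sum.elim a c) := by
    intro φ c
    refine (M.realize_rename (σ' := σ) ρ φ _).trans (iff_of_eq ?_)
    congr 1
    funext x
    rcases x with y | z <;> rfl
  obtain ⟨c, hc⟩ := hM.saturated Z (fun _ => PUnit.unit) hZ (Formula.rename (σ' := σ) ρ '' Φ)
    ((mk_image_le.trans (mk_set_le _)).trans_lt (hsmall (Y ⊕ Z) (by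
      rw [mk_sum, lift_id, lift_id]; exact add_lt_of_lt hκ hY hZ))) (by
    intro Φ₀ hΦ₀ hfin
    obtain ⟨Ψ, hΨ, hΨf, rfl⟩ := Set.exists_subset_image_finite_and.1 ⟨Φ₀, hΦ₀, hfin, rfl⟩
    obtain ⟨c, hc⟩ := h Ψ hΨ hΨf
    refine ⟨c, ?_⟩
    rintro _ ⟨φ, hφ, rfl⟩
    exact (key φ c).2 (hc φ hφ))
  exact ⟨c, fun φ hφ => (key φ c).1 (hc _ ⟨φ, hφ, rfl⟩)⟩

namespace FiberCompact

theorem exists_forall_mem (hM : FiberCompact κ M) {ι : Type*} {Y Z : Type u} (hY : #Y < κ)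
    (hZ : #Z < κ) {D : ι → Set (RTuple M (Y ⊕ Z))} (hD : ∀ i, TypeDefinable (D i)) (a : RTuple M Y)
    (h : ∀ s : Finset ι, ∃ c : RTuple M Z, ∀ i ∈ s, Sum.elim a c ∈ D i) :
    ∃ c : RTuple M Z, ∀ i, Sum.elim a c ∈ D i := by
  classical
  choose Φ hΦ using hD
  simp only [hΦ, Set.mem_ofPred_eq] at h ⊢
  obtain ⟨c, hc⟩ := hM Y Z hY hZ (⋃ i, Φ i) a (by
    intro Φ₀ hΦ₀ hfin
    obtain ⟨I, hI, hI'⟩ := Set.finite_subset_iUnion hfin hΦ₀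
    obtain ⟨c, hc⟩ := h hI.toFinset
    refine ⟨c, fun φ hφ => ?_⟩
    obtain ⟨i, hi, hφi⟩ := Set.mem_iUnion₂.1 (hI' hφ)
    exact hc i (hI.mem_toFinset.2 hi) φ hφi)
  exact ⟨c, fun i φ hφ => hc φ (Set.mem_iUnion.2 ⟨i, hφ⟩)⟩

theorem exists_mem_iInter (hM : FiberCompact κ M) (hκ : ℵ₀ ≤ κ) {ι : Type*} {Z : Type u}
    (hZ : #Z < κ) {D : ι → Set (RTuple M Z)} (hD : ∀ i, TypeDefinable (D i))
    (h : ∀ s : Finset ι, ∃ c : RTuple M Z, ∀ i ∈ s, c ∈ D i) :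
    ∃ c : RTuple M Z, ∀ i, c ∈ D i :=
  hM.exists_forall_mem (Y := PEmpty) (by rw [mk_pempty]; exact aleph0_pos.trans_le hκ) hZ
    (fun i => (hD i).preimage Sum.inr) (fun y => y.elim) h

/-- By compactness, the quantifier over `c` may be moved inside the intersection over finite
conjunctions from the defining set. -/
theorem typeDefinable_exists (hM : FiberCompact κ M) {Y Z : Type u} (hY : #Y < κ) (hZ : #Z < κ)
    {D : Set (RTuple M (Y ⊕ Z))} (hD : TypeDefinable D) :
    TypeDefinable {a : RTuple M Y | ∃ c : RTuple M Z, Sum.elim a c ∈ D} := by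
  obtain ⟨Φ, rfl⟩ := hD
  have : {a : RTuple M Y | ∃ c : RTuple M Z, Sum.elim a c ∈ {a | M.RealizeSet Φ a}} =
      ⋂ s : {s : List (RFormula L (Y ⊕ Z)) // ∀ φ ∈ s, φ ∈ Φ},
        {a | ∃ c : RTuple M Z, M.Realize (conj s.1) (Sum.elim a c)} := by
    ext a
    simp only [Set.mem_ofPred_eq, Set.mem_iInter]
    constructor
    · rintro ⟨c, hc⟩ ⟨s, hs⟩
      exact ⟨c, (M.realize_conj _ _).2 fun φ hφ => hc φ (hs φ hφ)⟩
    · intro h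
      refine hM Y Z hY hZ Φ a fun Φ₀ hΦ₀ hfin => ?_
      obtain ⟨c, hc⟩ := h ⟨hfin.toFinset.toList, fun φ hφ => hΦ₀ (by simpa using hφ)⟩
      exact ⟨c, fun φ hφ => (M.realize_conj _ _).1 hc φ (by simpa using hφ)⟩
  rw [this]
  exact .iInter fun s => typeDefinable_exists_formula _

end FiberCompact

end TypeDefinable

/-! ### Types in existentially closed models -/

section ExistentiallyClosed

variable {S : Type u} {L : Signature S} {T : Theory L} {M : Str L}

theorem Theory.IsEC.tp_eq_of_subset (hM : T.IsEC M) {X : Type u} {σ : X → S} {a b : M.Tuple σ}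
    (h : M.tp a ⊆ M.tp b) : M.tp a = M.tp b := by
  refine h.antisymm fun φ hφ => ?_
  by_contra hcon
  obtain ⟨ψ, hψ, hφψ⟩ := hM.2 X σ φ a hcon
  exact hφψ M hM.1 b ⟨hφ, h hψ⟩

theorem Theory.IsEC.isType_tp (hM : T.IsEC M) {X : Type u} {σ : X → S} (a : M.Tuple σ) :
    T.IsType (M.tp a) := by
  refine ⟨⟨M, hM.1, a, fun φ hφ => hφ⟩, ?_⟩
  rintro q ⟨N, hN, b, hb⟩ hq φ hφ
  by_contra hcon
  obtain ⟨ψ, hψ, hφψ⟩ := hM.2 X σ φ a hcon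
  exact hφψ N hN b ⟨hb φ hφ, hb ψ (hq hψ)⟩

/-- With joint embedding, an e.c. model has elements of every sort inhabited in some model. -/
theorem Theory.IsEC.nonempty_carrier (hM : T.IsEC M) (hT : T.JEP) {N : Str L} (hN : N.Models T)
    {s : S} (c : N.carrier s) : Nonempty (M.carrier s) := by
  by_contra hcon
  obtain ⟨ψ, hψ, hφψ⟩ := hM.2 PEmpty (fun x => x.elim) (.ex s .top) (fun x => x.elim)
    fun ⟨c, _⟩ => hcon ⟨c⟩
  let ψ' : Formula L (Empty.elim : Empty → S) := Formula.subst (fun x => x.elim) ψ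
  have hψ' : ∀ N : Str L, N.Realize ψ' (fun x => x.elim) ↔ N.Realize ψ (fun x => x.elim) := by
    intro N
    refine (N.realize_subst _ _ _).trans (iff_of_eq ?_)
    congr 1
    funext x
    exact x.elim
  rcases hT (.ex s .top) ψ' (fun N hN => by
    by_contra! h
    exact hφψ N hN (fun x => x.elim) ⟨⟨h.1.choose, trivial⟩, (hψ' N).1 h.2⟩) with h | h
  · exact h N hN ⟨c, trivial⟩
  · exact h M hM.1 ((hψ' M).2 hψ)

end ExistentiallyClosed


/-! ### Extraction of indiscernible sequences -/

section Extraction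

variable {L : OneSorted.{u}} {M : Str L} {κ μ B : Cardinal.{u}} {Y : Type u}

/-- A set of formulas `ψ(x_1, …, x_n)` to be imposed on the increasing tuples of a sequence. -/
abbrev Pattern (L : OneSorted.{u}) (Y : Type u) : Type u := Set (Σ n : ℕ, RFormula L (Fin n × Y))

/-- All increasing tuples of the sequence `a` satisfy the pattern `Γ`. -/
def Pattern.SatOn (Γ : Pattern L Y) {I : Type*} [Preorder I] (a : I → RTuple M Y) : Prop :=
  ∀ γ ∈ Γ, ∀ i : Fin γ.1 → I, StrictMono i → M.Realize γ.2 (fun p => a (i p.1) p.2)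

theorem Pattern.SatOn.comp {Γ : Pattern L Y} {I J : Type*} [Preorder I] [Preorder J]
    {a : I → RTuple M Y} (h : Γ.SatOn a) {f : J → I} (hf : StrictMono f) : Γ.SatOn (a ∘ f) :=
  fun γ hγ i hi => h γ hγ (f ∘ i) (hf.comp hi)

theorem Pattern.exists_satOn (hM : FiberCompact κ M) (hκ : ℵ₀ ≤ κ) (hY : #Y < κ)
    (Γ : Pattern L Y) (I : Type u) [Preorder I] (hI : #I < κ)
    (h : ∀ Γ₀ ⊆ Γ, Γ₀.Finite → ∀ F : Finset I, ∃ a : I → RTuple M Y, ∀ γ ∈ Γ₀,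
      ∀ i : Fin γ.1 → I, StrictMono i → (∀ k, i k ∈ F) →
        M.Realize γ.2 (fun p => a (i p.1) p.2)) :
    ∃ a : I → RTuple M Y, Γ.SatOn a := by
  classical
  let D : (Σ γ : Γ, {i : Fin γ.1.1 → I // StrictMono i}) → Set (RTuple M (I × Y)) :=
    fun t => {a | M.Realize t.1.1.2 (fun p => a (t.2.1 p.1, p.2))}
  obtain ⟨c, hc⟩ := hM.exists_mem_iInter hκ (D := D)
    (by rw [mk_prod, lift_id, lift_id]; exact mul_lt_of_lt hκ hI hY)
    (fun t => (typeDefinable_formula t.1.1.2).preimage fun p => (t.2.1 p.1, p.2)) (by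
      intro s
      obtain ⟨a, ha⟩ := h
        ((fun t => t.1.1) '' (s : Set (Σ γ : Γ, {i : Fin γ.1.1 → I // StrictMono i})))
        (by rintro _ ⟨t, -, rfl⟩; exact t.1.2) (s.finite_toSet.image _)
        (s.biUnion fun t => Finset.univ.image t.2.1)
      exact ⟨fun p => a p.1 p.2, fun t ht => ha _ ⟨t, ht, rfl⟩ t.2.1 t.2.2
        fun k => Finset.mem_biUnion.2 ⟨t, ht, Finset.mem_image_of_mem _ (Finset.mem_univ k)⟩⟩)
  exact ⟨fun i y => c (i, y), fun γ hγ i hi => hc ⟨⟨γ, hγ⟩, ⟨i, hi⟩⟩⟩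

theorem Pattern.SatOn.stretch (hM : FiberCompact κ M) (hκ : ℵ₀ ≤ κ) (hY : #Y < κ)
    {Γ : Pattern L Y} {a : ℕ → RTuple M Y} (ha : Γ.SatOn a) (I : Type u) [LinearOrder I]
    (hI : #I < κ) : ∃ b : I → RTuple M Y, Γ.SatOn b := by
  refine Γ.exists_satOn hM hκ hY I hI fun Γ₀ hΓ₀ _ F =>
    -- The rank of `i` within the finite set `F` is strictly increasing on `F`, so it carries
    -- increasing tuples from `F` to increasing tuples of the given sequence.
    ⟨fun i => a (F.filter (· < i)).card, fun γ hγ i hi hF => ?_⟩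
  refine ha γ (hΓ₀ hγ) (fun k => (F.filter (· < i k)).card) fun k l hkl => ?_
  refine Finset.card_lt_card ((Finset.ssubset_iff_of_subset ?_).2 ⟨i k, ?_, ?_⟩)
  · intro x hx
    rw [Finset.mem_filter] at hx ⊢
    exact ⟨hx.1, hx.2.trans (hi hkl)⟩
  · exact Finset.mem_filter.2 ⟨hF k, hi hkl⟩
  · simp

/-- A pattern satisfied by some `ω`-sequence is contained in a maximal such pattern. -/
theorem Pattern.SatOn.exists_maximal (hM : FiberCompact κ M) (hκ : ℵ₀ < κ) (hY : #Y < κ)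
    {Γ : Pattern L Y} {a : ℕ → RTuple M Y} (ha : Γ.SatOn a) :
    ∃ Γ' : Pattern L Y, Γ ⊆ Γ' ∧
      Maximal (fun Δ : Pattern L Y => ∃ a : ℕ → RTuple M Y, Δ.SatOn a) Γ' := by
  refine zorn_subset_nonempty {Δ : Pattern L Y | ∃ a : ℕ → RTuple M Y, Δ.SatOn a}
    (fun c hc hchain hne => ⟨⋃₀ c, ?_, fun s hs => Set.subset_sUnion_of_mem hs⟩) Γ ⟨a, ha⟩
  obtain ⟨b, hb⟩ := Pattern.exists_satOn (M := M) hM hκ.le hY (⋃₀ c) (ULift.{u} ℕ)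
    (by simpa using hκ) (by
      intro Γ₀ hΓ₀ hfin F
      obtain ⟨Δ, hΔ, hsub⟩ := DirectedOn.exists_mem_subset_of_finite_of_subset_sUnion hne
        hchain.directedOn hfin hΓ₀
      obtain ⟨a, ha⟩ := hc hΔ
      exact ⟨fun i => a i.down, fun γ hγ i hi _ =>
        ha γ (hsub hγ) (fun k => (i k).down) fun k l hkl => hi hkl⟩)
  exact ⟨fun n => b ⟨n⟩, hb.comp (f := ULift.up) fun _ _ h => h⟩

/-- Formulas outside a maximal pattern contradict it. -/
theorem Pattern.exists_contradicting {T : Theory L} (hT : T.IsEC M) (hM : FiberCompact κ M)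
    (hB : B.IsStrongLimit) (hB₀ : ℵ₀ < B) (hBκ : B ≤ κ) (hY : #Y < κ) {n : ℕ}
    (hC : #(RFormula L (Fin n × Y)) < B) {Γ : Pattern L Y}
    (hΓ : Maximal (fun Δ : Pattern L Y => ∃ a : ℕ → RTuple M Y, Δ.SatOn a) Γ)
    (ψ : RFormula L (Fin n × Y)) :
    ∃ χ : RFormula L (Fin n × Y), ⟨n, χ⟩ ∈ Γ ∧
      (χ = ψ ∨ ∀ b : RTuple M (Fin n × Y), ¬ (M.Realize ψ b ∧ M.Realize χ b)) := by
  -- The colour of a tuple is `ψ` if the tuple satisfies `ψ`, and otherwise a formula true of it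
  -- that contradicts `ψ`, supplied by existential closedness.
  have hcol : ∀ d : RTuple M (Fin n × Y), ∃ χ : RFormula L (Fin n × Y), M.Realize χ d ∧
      (χ = ψ ∨ ∀ b : RTuple M (Fin n × Y), ¬ (M.Realize ψ b ∧ M.Realize χ b)) := by
    intro d
    by_cases hd : M.Realize ψ d
    · exact ⟨ψ, hd, .inl rfl⟩
    · obtain ⟨χ, hχ, h⟩ := hT.2 _ _ ψ d hd
      exact ⟨χ, hχ, .inr (h M hT.1)⟩
  choose col hcol₁ hcol₂ using hcol
  obtain ⟨I, _, _, hI, hhom⟩ := exists_homogeneous hB hB₀ (RFormula L (Fin n × Y)) hC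
    (ULift.{u} ℕ) (by simpa using hB₀) n
  obtain ⟨a, ha⟩ := hΓ.prop
  obtain ⟨d, hd⟩ := ha.stretch hM (hB₀.le.trans hBκ) hY I (hI.trans_le hBκ)
  obtain ⟨b, χ, hb, hχ⟩ := hhom fun i => col fun p => d (i p.1) p.2
  have hb' : StrictMono fun k : ℕ => b ⟨k⟩ := fun _ _ h => hb h
  have hχ' : ∀ i : Fin n → ℕ, StrictMono i → col (fun p => d (b ⟨i p.1⟩) p.2) = χ :=
    fun i hi => hχ (fun k => ⟨i k⟩) fun _ _ h => hi h
  refine ⟨χ, ?_, ?_⟩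
  -- The homogeneous subsequence still satisfies `Γ` and satisfies `χ` on all increasing tuples, so
  -- maximality puts `χ` into `Γ`.
  · refine hΓ.le_of_ge (y := insert ⟨n, χ⟩ Γ) ⟨fun k => d (b ⟨k⟩), ?_⟩ (Set.subset_insert _ _)
      (Set.mem_insert _ _)
    rintro γ (rfl | hγ) i hi
    · exact hχ' i hi ▸ hcol₁ _
    · exact hd.comp hb' γ hγ i hi
  · rw [← hχ' (fun k => k) fun _ _ h => h]
    exact hcol₂ _

/-- A pattern satisfied by some `ω`-sequence is satisfied by an indiscernible one. -/
theorem Pattern.SatOn.exists_indiscernible {T : Theory L} (hT : T.IsEC M) (hM : FiberCompact κ M)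
    (hB : B.IsStrongLimit) (hB₀ : ℵ₀ < B) (hBκ : B ≤ κ) (hY : #Y < κ)
    (hC : ∀ n, #(RFormula L (Fin n × Y)) < B) {Γ : Pattern L Y} {a : ℕ → RTuple M Y}
    (ha : Γ.SatOn a) : ∃ b : ℕ → RTuple M Y, Γ.SatOn b ∧
      M.Indiscernible (σ := fun _ : Y => PUnit.unit) b := by
  obtain ⟨Γ', hΓ, hmax⟩ := ha.exists_maximal hM (hB₀.trans_le hBκ) hY
  obtain ⟨b, hb⟩ := hmax.prop
  refine ⟨b, fun γ hγ => hb γ (hΓ hγ), ?_⟩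
  have key : ∀ (n : ℕ) (i j : Fin n → ℕ), StrictMono i → StrictMono j →
      ∀ ψ : RFormula L (Fin n × Y), M.Realize ψ (fun p => b (i p.1) p.2) →
        M.Realize ψ (fun p => b (j p.1) p.2) := by
    intro n i j hi hj ψ h
    -- A maximal pattern decides every formula, so each sequence satisfying it is already
    -- indiscernible.
    obtain ⟨χ, hχ, rfl | hcon⟩ := exists_contradicting hT hM hB hB₀ hBκ hY (hC n) hmax ψ
    · exact hb _ hχ j hj
    · exact (hcon _ ⟨h, hb _ hχ i hi⟩).elim
  exact fun n i j hi hj => Set.Subset.antisymm (key n i j hi hj) (key n j i hj hi)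

end Extraction


/-! ### Representatives, and translation of `L_𝓔`-formulas -/

namespace HypFamily

variable {L : OneSorted.{u}} {H : HypFamily L} {M : Str L} {κ μ : Cardinal.{u}}

/-- The standing assumptions on saturation of `M` and on the lengths of representatives. -/
structure SaturatedFor (H : HypFamily L) (M : Str L) (κ μ : Cardinal.{u}) : Prop where
  fiberCompact : FiberCompact κ M
  aleph0_le : ℵ₀ ≤ μ
  lt : μ < κ
  len_le : ∀ e, #(H.Len e) ≤ μ

/-- The index set of the real tuples that represent the elements of a sort. -/
def RepLen (H : HypFamily L) : HypSort H.Idx → Type u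
  | .real => PUnit
  | .hyp e => H.Len e

/-- The real variables that represent the variables `X` of sorts `σ`. -/
abbrev RepVar {X : Type u} (σ : X → HypSort H.Idx) : Type u := Σ x, H.RepLen (σ x)

/-- The element of a sort represented by a real tuple. -/
def cls (hE : H.IsEquiv M) : (s : HypSort H.Idx) → RTuple M (H.RepLen s) → hypCarrier hE s
  | .real, b => b PUnit.unit
  | .hyp e, b => Quotient.mk (setoid hE e) b

theorem cls_surjective (hE : H.IsEquiv M) (s : HypSort H.Idx) (c : hypCarrier hE s) :
    ∃ b, cls hE s b = c := by
  cases s with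
  | real => exact ⟨fun _ => c, rfl⟩
  | hyp e => exact Quotient.exists_rep c

/-- The tuple of elements of `M^𝓔` represented by a real tuple. -/
def clsTuple (hE : H.IsEquiv M) {X : Type u} {σ : X → HypSort H.Idx} (b : RTuple M (RepVar σ)) :
    (str hE).Tuple σ :=
  fun x => cls hE (σ x) fun l => b ⟨x, l⟩

theorem clsTuple_surjective (hE : H.IsEquiv M) {X : Type u} {σ : X → HypSort H.Idx}
    (c : (str hE).Tuple σ) : ∃ b, clsTuple hE b = c := by
  choose b hb using fun x => cls_surjective hE (σ x) (c x)
  exact ⟨fun z => b z.1 z.2, funext hb⟩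

theorem mk_repLen_le (hμ : ℵ₀ ≤ μ) (hLen : ∀ e, #(H.Len e) ≤ μ) (s : HypSort H.Idx) :
    #(H.RepLen s) ≤ μ := by
  cases s with
  | real => exact mk_punit.le.trans (one_lt_aleph0.le.trans hμ)
  | hyp e => exact hLen e

theorem mk_repVar_le (hμ : ℵ₀ ≤ μ) (hLen : ∀ e, #(H.Len e) ≤ μ) {X : Type u}
    (σ : X → HypSort H.Idx) : #(RepVar σ) ≤ #X * μ := by
  rw [mk_sigma, ← sum_const']
  exact sum_le_sum _ _ fun x => mk_repLen_le hμ hLen _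

theorem mk_repVar_lt (hS : H.SaturatedFor M κ μ) {X : Type u}
    (σ : X → HypSort H.Idx) (hX : #X < κ) : #(RepVar σ) < κ :=
  (mk_repVar_le hS.aleph0_le hS.len_le σ).trans_lt
    (mul_lt_of_lt (hS.aleph0_le.trans hS.lt.le) hX hS.lt)

theorem typeDefinable_cls_eq (hE : H.IsEquiv M) (s : HypSort H.Idx) :
    TypeDefinable {b : RTuple M (H.RepLen s ⊕ H.RepLen s) |
      cls hE s (fun l => b (.inl l)) = cls hE s (fun l => b (.inr l))} := by
  cases s with
  | real =>
    exact typeDefinable_formula (.equal (s := PUnit.unit)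
      (.var (σ := ctx (fun _ : H.RepLen .real ⊕ H.RepLen .real => PUnit.unit) [])
        (.inl (.inl PUnit.unit)))
      (.var (σ := ctx (fun _ : H.RepLen .real ⊕ H.RepLen .real => PUnit.unit) [])
        (.inl (.inr PUnit.unit))))
  | hyp e =>
    refine (congrArg TypeDefinable (Set.ext fun b => ?_)).mpr
      (typeDefinable_realizeSet (M := M) (H.E e))
    refine Quotient.eq.trans (iff_of_eq ?_)
    change M.RealizeSet (H.E e) _ = M.RealizeSet (H.E e) b
    congr 1
    funext x
    cases x <;> rfl

theorem typeDefinable_clsTuple_eq (hE : H.IsEquiv M) {X : Type u} (σ : X → HypSort H.Idx) :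
    TypeDefinable {b : RTuple M (RepVar σ ⊕ RepVar σ) |
      clsTuple hE (fun z => b (.inl z)) = clsTuple hE (fun z => b (.inr z))} := by
  have : {b : RTuple M (RepVar σ ⊕ RepVar σ) |
      clsTuple hE (fun z => b (.inl z)) = clsTuple hE (fun z => b (.inr z))} =
      ⋂ x, {b : RTuple M (RepVar σ ⊕ RepVar σ) |
        cls hE (σ x) (fun l => b (.inl ⟨x, l⟩)) = cls hE (σ x) fun l => b (.inr ⟨x, l⟩)} := by
    ext b
    simp only [Set.mem_ofPred_eq, Set.mem_iInter]
    exact funext_iff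
  rw [this]
  exact .iInter fun x => (typeDefinable_cls_eq hE (σ x)).preimage
    (Sum.map (fun l => (⟨x, l⟩ : RepVar σ)) fun l => (⟨x, l⟩ : RepVar σ))

/-- Real terms that represent a term of `L_𝓔`. -/
def realTerm {X : Type u} {σ : X → HypSort H.Idx} :
    {s : HypSort H.Idx} → Term H.lang σ s → H.RepLen s →
      Term L (fun _ : RepVar σ => PUnit.unit) PUnit.unit
  | _, .var x => fun l => .var ⟨x, l⟩
  | _, .app f ts => fun _ => .app (L := L) f fun i => realTerm (ts i) PUnit.unit

theorem cls_eval_realTerm (hE : H.IsEquiv M) {X : Type u} {σ : X → HypSort H.Idx}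
    {s : HypSort H.Idx} (t : Term H.lang σ s) (b : RTuple M (RepVar σ)) :
    cls hE s (fun l => M.eval b (realTerm t l)) = (str hE).eval (clsTuple hE b) t := by
  induction t with
  | var x => rfl
  | app f ts ih =>
    change M.func f (fun i => M.eval b (realTerm (ts i) PUnit.unit)) =
      M.func f (fun i => (str hE).eval (clsTuple hE b) (ts i))
    congr 1
    funext i
    exact ih i

/-- The values of the free variables represented by a real tuple. -/
def clsFree (hE : H.IsEquiv M) {X : Type u} {σ : X → HypSort H.Idx} {Γ : List (HypSort H.Idx)}
    (b : RTuple M (RepVar (ctx σ Γ))) : (str hE).Tuple σ :=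
  fun x => clsTuple hE b (.inl x)

/-- The values of the bound variables represented by a real tuple. -/
def clsBound (hE : H.IsEquiv M) {X : Type u} {σ : X → HypSort H.Idx} {Γ : List (HypSort H.Idx)}
    (b : RTuple M (RepVar (ctx σ Γ))) : (str hE).Tuple Γ.get :=
  fun k => clsTuple hE b (.inr k)

theorem append_clsFree (hE : H.IsEquiv M) {X : Type u} {σ : X → HypSort H.Idx}
    {Γ : List (HypSort H.Idx)} (b : RTuple M (RepVar (ctx σ Γ))) :
    (str hE).append (clsFree hE b) (clsBound hE b) = clsTuple hE b := by
  funext v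
  cases v <;> rfl

theorem eval_clsFree (hE : H.IsEquiv M) {X : Type u} {σ : X → HypSort H.Idx}
    {Γ : List (HypSort H.Idx)} (b : RTuple M (RepVar (ctx σ Γ))) {s : HypSort H.Idx}
    (t : Term H.lang (ctx σ Γ) s) :
    (str hE).eval ((str hE).append (clsFree hE b) (clsBound hE b)) t =
      cls hE s fun l => M.eval b (realTerm t l) := by
  rw [append_clsFree, cls_eval_realTerm]

/-- The real variable that represents a new bound variable. -/
def repBound {X : Type u} (σ : X → HypSort H.Idx) (Γ : List (HypSort H.Idx)) (s : HypSort H.Idx) :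
    RepVar (ctx σ (s :: Γ)) → RepVar (ctx σ Γ) ⊕ H.RepLen s
  | ⟨.inl x, l⟩ => .inl ⟨.inl x, l⟩
  | ⟨.inr ⟨0, _⟩, l⟩ => .inr l
  | ⟨.inr ⟨k + 1, h⟩, l⟩ => .inl ⟨.inr ⟨k, Nat.lt_of_succ_lt_succ h⟩, l⟩

/-- The set defined in `M^𝓔` by an `L_𝓔`-formula is type-definable in terms of representatives. -/
theorem typeDefinable_bRealize (hS : H.SaturatedFor M κ μ) (hE : H.IsEquiv M) {X : Type u}
    (hX : #X < κ) {σ : X → HypSort H.Idx} {Γ : List (HypSort H.Idx)} (φ : BFormula H.lang σ Γ) :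
    TypeDefinable {b : RTuple M (RepVar (ctx σ Γ)) |
      (str hE).BRealize (clsFree hE b) φ (clsBound hE b)} := by
  have hsmall : ∀ Γ, #(RepVar (ctx σ Γ)) < κ := fun Γ => mk_repVar_lt hS _ <| by
    rw [mk_sum]
    simpa using add_lt_of_lt (hS.aleph0_le.trans hS.lt.le) hX
      ((natCast_lt_aleph0 (n := Γ.length)).trans_le
      (hS.aleph0_le.trans hS.lt.le))
  induction φ with
  | top => exact typeDefinable_formula .top
  | bot => exact typeDefinable_formula .bot
  | @equal Γ s t₁ t₂ =>
    convert (typeDefinable_cls_eq hE s).subst (Sum.elim (realTerm t₁) (realTerm t₂)) using 1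
    ext b
    simp only [Set.mem_ofPred_eq, Str.BRealize, Sum.elim_inl, Sum.elim_inr, eval_clsFree]
    rfl
  | @rel Γ R ts =>
    rcases R with R | R
    · convert typeDefinable_formula (M := M) (Y := RepVar (ctx σ Γ)) (.rel R fun i =>
        (realTerm (ts i) PUnit.unit).inCtx) using 1
      ext b
      change M.rel R _ ↔ M.rel R _
      simp only [Str.eval_inCtx]
      exact iff_of_eq (congrArg _ (funext fun i => eval_clsFree hE b (ts i)))
    -- A new symbol quantifies over representatives `c` of its hyperimaginary arguments. The matrix
    -- is the type-definable condition that `c` represents the right classes and satisfies `R.φ`.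
    · let Z : Type u := Σ j : Fin R.m, H.Len (R.e j)
      let ren : Term L (fun _ : RepVar (ctx σ Γ) => PUnit.unit) PUnit.unit →
          Term L (fun _ : RepVar (ctx σ Γ) ⊕ Z => PUnit.unit) PUnit.unit :=
        Term.subst (σ := fun _ : RepVar (ctx σ Γ) => PUnit.unit) fun v => .var (.inl v)
      have hren : ∀ t (d : RTuple M (RepVar (ctx σ Γ))) (c : RTuple M Z),
          M.eval (Sum.elim d c : RTuple M _) (ren t) = M.eval d t := fun t d c => M.eval_subst _ _ t
      have hZ : #Z < κ := by
        refine lt_of_le_of_lt ?_ hS.lt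
        rw [mk_sigma]
        refine (sum_le_sum _ (fun _ => μ) fun j => hS.len_le _).trans ?_
        simpa using mul_le_of_le hS.aleph0_le
          ((natCast_lt_aleph0 (n := R.m)).le.trans hS.aleph0_le) le_rfl
      have h₁ := fun j : Fin R.m => (typeDefinable_cls_eq hE (.hyp (R.e j))).subst
          (Y := RepVar (ctx σ Γ) ⊕ Z)
          (Sum.elim (fun l => .var (.inr ⟨j, l⟩)) fun l => ren (realTerm (ts (.inr j)) l))
      have h₂ := (typeDefinable_formula (M := M) R.φ).subst (Y := RepVar (ctx σ Γ) ⊕ Z)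
          (Sum.elim (fun i => ren (realTerm (ts (.inl i)) PUnit.unit)) fun z => .var (.inr z))
      convert hS.fiberCompact.typeDefinable_exists (hsmall Γ) hZ
        ((TypeDefinable.iInter h₁).inter h₂) using 1
      ext b
      have hl : ∀ i : Fin R.n, (str hE).eval ((str hE).append (clsFree hE b) (clsBound hE b))
          (ts (.inl i)) = M.eval b (realTerm (ts (.inl i)) PUnit.unit) :=
        fun i => eval_clsFree hE b (ts (.inl i))
      have hr : ∀ j : Fin R.m, (str hE).eval ((str hE).append (clsFree hE b) (clsBound hE b))
          (ts (.inr j)) = cls hE (.hyp (R.e j)) fun l => M.eval b (realTerm (ts (.inr j)) l) :=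
        fun j => eval_clsFree hE b (ts (.inr j))
      have hφ : ∀ c : RTuple M Z,
          (Sum.elim (fun i => (str hE).eval ((str hE).append (clsFree hE b) (clsBound hE b))
            (ts (.inl i))) c : RTuple M (Fin R.n ⊕ Z)) = fun z => M.eval (Sum.elim b c : RTuple M _)
              (Sum.elim (fun i => ren (realTerm (ts (.inl i)) PUnit.unit))
                (fun z => .var (.inr z)) z) := by
        intro c
        funext z
        rcases z with i | z
        · exact (hl i).trans (hren _ b c).symm
        · rfl
      have hcls : ∀ (c : RTuple M Z) (j : Fin R.m),
          (cls hE (.hyp (R.e j)) (fun l => c ⟨j, l⟩) =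
            (str hE).eval ((str hE).append (clsFree hE b) (clsBound hE b)) (ts (.inr j))) ↔
          (Sum.elim b c : RTuple M _) ∈ {d : RTuple M (RepVar (ctx σ Γ) ⊕ Z) |
            (fun z => M.eval d ((Sum.elim (fun l => .var (.inr ⟨j, l⟩))
              fun l => ren (realTerm (ts (.inr j)) l) :
                _ → Term L (fun _ : RepVar (ctx σ Γ) ⊕ Z => PUnit.unit) PUnit.unit) z)) ∈
            {b : RTuple M (H.RepLen (.hyp (R.e j)) ⊕ H.RepLen (.hyp (R.e j))) |
              cls hE _ (fun l => b (.inl l)) = cls hE _ (fun l => b (.inr l))}} := by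
        intro c j
        rw [hr]
        have : (fun l => M.eval b (realTerm (ts (.inr j)) l)) =
            fun l => M.eval (Sum.elim b c : RTuple M _) (ren (realTerm (ts (.inr j)) l)) :=
          funext fun l => (hren _ b c).symm
        exact iff_of_eq (congrArg (fun w => cls hE (.hyp (R.e j)) (fun l => c ⟨j, l⟩) =
          cls hE (.hyp (R.e j)) w) this)
      constructor
      · rintro ⟨c, hc, h⟩
        refine ⟨fun z => c z.1 z.2, Set.mem_iInter.2 fun j => (hcls _ j).1 (hc j), ?_⟩
        rw [hφ fun z => c z.1 z.2] at h
        exact h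
      · rintro ⟨c, hc, h⟩
        refine ⟨fun j l => c ⟨j, l⟩, fun j => (hcls c j).2 (Set.mem_iInter.1 hc j), ?_⟩
        have := hφ c
        refine Eq.mpr (congrArg (M.Realize R.φ) this) h
  | and φ ψ ih₁ ih₂ => exact ih₁.inter ih₂
  | or φ ψ ih₁ ih₂ => exact ih₁.union ih₂
  | @ex Γ s φ ih =>
    -- Quantifying over an element of a sort amounts to quantifying over a real tuple representing
    -- it, of length at most `μ`.
    convert hS.fiberCompact.typeDefinable_exists (hsmall Γ)
      ((mk_repLen_le hS.aleph0_le hS.len_le s).trans_lt hS.lt)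
      (ih.preimage (repBound σ Γ s)) using 1
    ext b
    have key : ∀ c : RTuple M (H.RepLen s),
        (str hE).BRealize (clsFree hE b) φ (Fin.cons
          (α := fun i => (str hE).carrier ((s :: Γ).get i)) (cls hE s c) (clsBound hE b)) ↔
        (str hE).BRealize (clsFree hE fun z => (Sum.elim b c : RTuple M _) (repBound σ Γ s z)) φ
          (clsBound hE fun z => (Sum.elim b c : RTuple M _) (repBound σ Γ s z)) := by
      intro c
      refine iff_of_eq (congrArg _ ?_)
      funext k
      rcases k with ⟨_ | k, hk⟩ <;> rfl
    constructor
    · rintro ⟨c, hc⟩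
      obtain ⟨c, rfl⟩ := cls_surjective hE s c
      exact ⟨c, (key c).1 hc⟩
    · rintro ⟨c, hc⟩
      exact ⟨cls hE s c, (key c).2 hc⟩

end HypFamily


/-! ### Translation of `L`-formulas, and lifting to representatives -/

namespace HypFamily

variable {L : OneSorted.{u}} {H : HypFamily L} {M : Str L} {κ μ : Cardinal.{u}}

theorem typeDefinable_realize (hS : H.SaturatedFor M κ μ) (hE : H.IsEquiv M) {X : Type u}
    (hX : #X < κ) {σ : X → HypSort H.Idx} (φ : Formula H.lang σ) :
    TypeDefinable {b : RTuple M (RepVar σ) | (str hE).Realize φ (clsTuple hE b)} := by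
  let f : RepVar (ctx σ []) → RepVar σ := fun
    | ⟨.inl x, l⟩ => ⟨x, l⟩
    | ⟨.inr k, _⟩ => k.elim0
  convert (typeDefinable_bRealize hS hE hX φ).preimage f using 1
  ext b
  refine iff_of_eq ?_
  change (str hE).BRealize _ _ _ = (str hE).BRealize _ _ _
  congr 1
  funext k
  exact k.elim0

theorem tp_clsTuple_subset (hS : H.SaturatedFor M κ μ) (hE : H.IsEquiv M) {X : Type u}
    (hX : #X < κ) {σ : X → HypSort H.Idx} {a b : RTuple M (RepVar σ)}
    (h : M.tp (σ := fun _ => PUnit.unit) a ⊆ M.tp (σ := fun _ => PUnit.unit) b) :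
    (str hE).tp (clsTuple hE a) ⊆ (str hE).tp (clsTuple hE b) :=
  fun φ hφ => (typeDefinable_realize hS hE hX φ).mem_of_tp_subset h hφ

/-- The sorts enter through the equation `hσ` because in the application they have the form `σ (ι
k)`, which is not definitionally a `Sum.elim`. -/
theorem exists_repFormula_of_sum (hE : H.IsEquiv M) {n m : ℕ} (e : Fin m → H.Idx)
    {σ : Fin n ⊕ Fin m → HypSort H.Idx} (hσ : σ = Sum.elim (fun _ => .real) fun j => .hyp (e j))
    (ψ : RFormula L (Σ x, H.RepLen (σ x))) : ∃ φ : Formula H.lang σ, ∀ c : (str hE).Tuple σ,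
      (str hE).Realize φ c ↔ ∃ b : (Σ x, H.RepLen (σ x)) → M.carrier PUnit.unit,
        (∀ x, cls hE (σ x) (fun l => b ⟨x, l⟩) = c x) ∧ M.Realize ψ b := by
  subst hσ
  let σ : Fin n ⊕ Fin m → HypSort H.Idx := Sum.elim (fun _ => .real) fun j => .hyp (e j)
  let f : (Σ x, H.RepLen (σ x)) → Fin n ⊕ (Σ j, H.Len (e j)) := fun
    | ⟨.inl i, _⟩ => .inl i
    | ⟨.inr j, l⟩ => .inr ⟨j, l⟩
  let R : H.NewRel := ⟨n, m, e, Formula.rename (σ' := fun _ => PUnit.unit) f ψ⟩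
  refine ⟨.rel (L := H.lang) (.inr R) fun
    | .inl i => .var (σ := ctx σ []) (.inl (.inl i))
    | .inr j => .var (σ := ctx σ []) (.inl (.inr j)), fun c => ?_⟩
  have hR : ∀ b : Fin n ⊕ (Σ j, H.Len (e j)) → M.carrier PUnit.unit,
      M.Realize R.φ b ↔ M.Realize ψ (fun z => b (f z)) := fun b => M.realize_rename _ _ _
  constructor
  · rintro ⟨b, hb, h⟩
    refine ⟨_, ?_, (hR _).1 h⟩
    rintro (i | j)
    · rfl
    · exact hb j
  · rintro ⟨b, hb, h⟩
    refine ⟨fun j l => b ⟨.inr j, l⟩, fun j => hb (.inr j), (hR _).2 ?_⟩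
    convert h using 1
    funext z
    rcases z with ⟨i | j, l⟩
    · exact (hb (.inl i)).symm
    · rfl

/-- `L`-formulas in representatives give `L_𝓔`-formulas. -/
theorem exists_repFormula (hE : H.IsEquiv M) {X : Type u} {σ : X → HypSort H.Idx}
    (ψ : RFormula L (RepVar σ)) : ∃ φ : Formula H.lang σ, ∀ c : (str hE).Tuple σ,
      (str hE).Realize φ c ↔ ∃ b, clsTuple hE b = c ∧ M.Realize ψ b := by
  obtain ⟨A, hA, hψ⟩ := Formula.exists_finite_support ψ
  have hfin : ∀ p : X → Prop, Finite {x : X // x ∈ Sigma.fst '' A ∧ p x} := fun p =>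
    ((hA.image Sigma.fst).subset fun x hx => hx.1 : {x | x ∈ Sigma.fst '' A ∧ p x}.Finite)
  have := hfin fun x => σ x = .real
  have := hfin fun x => ∃ e, σ x = .hyp e
  obtain ⟨n, ⟨er⟩⟩ := Finite.exists_equiv_fin {x : X // x ∈ Sigma.fst '' A ∧ σ x = .real}
  obtain ⟨m, ⟨eh⟩⟩ := Finite.exists_equiv_fin {x : X // x ∈ Sigma.fst '' A ∧ ∃ e, σ x = .hyp e}
  choose e he using fun j => (eh.symm j).2.2
  let ι : Fin n ⊕ Fin m → X := Sum.elim (fun i => (er.symm i).1) fun j => (eh.symm j).1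
  have hι : ι.Injective := by
    rintro (i | j) (i' | j') h
    · exact congrArg _ (er.symm.injective (Subtype.ext h))
    · have := (er.symm i).2.2
      rw [show (er.symm i).1 = (eh.symm j').1 from h, he] at this
      exact nomatch this
    · have := (er.symm i').2.2
      rw [show (er.symm i').1 = (eh.symm j).1 from h.symm, he] at this
      exact nomatch this
    · exact congrArg _ (eh.symm.injective (Subtype.ext h))
  have hι' : ∀ x ∈ Sigma.fst '' A, ∃ k, ι k = x := by
    intro x hx
    cases hs : σ x with
    | real => exact ⟨.inl (er ⟨x, hx, hs⟩), by simp [ι]⟩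
    | hyp e => exact ⟨.inr (eh ⟨x, hx, e, hs⟩), by simp [ι]⟩
  let f : (Σ k, H.RepLen (σ (ι k))) → RepVar σ := fun z => ⟨ι z.1, z.2⟩
  obtain ⟨ψ', hψ'⟩ := hψ f (by
    rintro ⟨x, l⟩ hx
    obtain ⟨k, rfl⟩ := hι' x ⟨_, hx, rfl⟩
    exact ⟨⟨k, l⟩, rfl⟩)
  obtain ⟨φ, hφ⟩ := exists_repFormula_of_sum hE (σ := fun k => σ (ι k)) e (by
    funext k
    rcases k with i | j
    · exact (er.symm i).2.2
    · exact he j) ψ'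
  refine ⟨Formula.rename ι φ, fun c => ?_⟩
  rw [Str.realize_rename, hφ]
  constructor
  · rintro ⟨b, hb, h⟩
    -- Coordinates outside the support of `ψ` receive arbitrary representatives.
    have : ∀ x, ∃ d : RTuple M (H.RepLen (σ x)), cls hE (σ x) d = c x ∧
        ∀ k (hk : ι k = x) (l : H.RepLen (σ (ι k))), d (hk ▸ l) = b ⟨k, l⟩ := by
      intro x
      by_cases hx : ∃ k, ι k = x
      · obtain ⟨k, rfl⟩ := hx
        refine ⟨fun l => b ⟨k, l⟩, hb k, fun k' hk l => ?_⟩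
        obtain rfl := hι hk
        rfl
      · obtain ⟨d, hd⟩ := cls_surjective hE _ (c x)
        exact ⟨d, hd, fun k hk => (hx ⟨k, hk⟩).elim⟩
    choose d hd hd' using this
    refine ⟨fun z => d z.1 z.2, funext hd, ?_⟩
    rw [← hψ']
    convert h using 1
    funext z
    exact hd' _ z.1 rfl z.2
  · rintro ⟨b, rfl, h⟩
    exact ⟨fun z => b (f z), fun _ => rfl, (hψ' M b).2 h⟩

/-- If `c` satisfies all `L_𝓔`-formulas valid in a set of tuples that have representatives
satisfying `Φ`, then `c` has such representatives. -/
theorem exists_rep_realizeSet (hS : H.SaturatedFor M κ μ) (hE : H.IsEquiv M) {X : Type u}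
    (hX : #X < κ) {σ : X → HypSort H.Idx} (Φ : Set (RFormula L (RepVar σ)))
    (K : Set ((str hE).Tuple σ)) (hK : ∀ c ∈ K, ∃ b, clsTuple hE b = c ∧ M.RealizeSet Φ b)
    (c : (str hE).Tuple σ)
    (hc : ∀ φ : Formula H.lang σ, (∀ d ∈ K, (str hE).Realize φ d) → (str hE).Realize φ c) :
    ∃ b, clsTuple hE b = c ∧ M.RealizeSet Φ b := by
  classical
  obtain ⟨a, rfl⟩ := clsTuple_surjective hE c
  -- With a representative `a` of `c` as parameter, the type to be realised says that `b` represents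
  -- the same classes as `a` and satisfies `Φ`.
  let D : Option Φ → Set (RTuple M (RepVar σ ⊕ RepVar σ))
    | none => {b | clsTuple hE (fun z => b (.inl z)) = clsTuple hE (fun z => b (.inr z))}
    | some φ => {b | M.Realize φ.1 (fun z => b (.inr z))}
  obtain ⟨b, hb⟩ := hS.fiberCompact.exists_forall_mem (mk_repVar_lt hS σ hX)
    (mk_repVar_lt hS σ hX) (D := D) (by
      rintro (_ | φ)
      · exact typeDefinable_clsTuple_eq hE σ
      · exact (typeDefinable_formula φ.1).preimage Sum.inr) a (by
      intro s
      obtain ⟨φ, hφ⟩ := exists_repFormula hE (conj ((Finset.eraseNone s).toList.map Subtype.val))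
      obtain ⟨b, hb, h⟩ := (hφ _).1 (hc φ fun d hd => by
        obtain ⟨b, rfl, hb⟩ := hK d hd
        refine (hφ _).2 ⟨b, rfl, (M.realize_conj _ _).2 fun χ hχ => ?_⟩
        obtain ⟨χ, -, rfl⟩ := List.mem_map.1 hχ
        exact hb _ χ.2)
      refine ⟨b, ?_⟩
      rintro (_ | χ) hχ
      · exact hb.symm
      · exact (M.realize_conj _ _).1 h _ (List.mem_map.2 ⟨χ, by simpa using hχ, rfl⟩))
  exact ⟨b, (hb none).symm, fun φ hφ => hb (some ⟨φ, hφ⟩)⟩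

theorem exists_rep_tp_eq {T : Theory L} (hT : T.IsEC M) (hS : H.SaturatedFor M κ μ)
    (hE : H.IsEquiv M) {X : Type u} (hX : #X < κ) {σ : X → HypSort H.Idx}
    (a : RTuple M (RepVar σ)) (c : (str hE).Tuple σ)
    (h : (str hE).tp (clsTuple hE a) ⊆ (str hE).tp c) :
    ∃ b, clsTuple hE b = c ∧
      M.tp (σ := fun _ => PUnit.unit) a = M.tp (σ := fun _ => PUnit.unit) b := by
  obtain ⟨b, hb, hab⟩ := exists_rep_realizeSet hS hE hX (M.tp (σ := fun _ => PUnit.unit) a)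
    {clsTuple hE a} (by rintro _ rfl; exact ⟨a, rfl, fun φ hφ => hφ⟩) c
    fun φ hφ => h (hφ _ rfl)
  exact ⟨b, hb, hT.tp_eq_of_subset hab⟩

theorem nonempty_of_extension (hE : H.IsEquiv M) {N : Str H.lang} (hN : N.Models (extension hE))
    {s : HypSort H.Idx} (c : N.carrier s) : Nonempty (hypCarrier hE s) := by
  by_contra hcon
  exact hN ⟨1, fun _ => s, .top, .bot⟩ (fun a _ => hcon ⟨a 0⟩) (fun _ => c) trivial

/-- Partial types of `T^𝓔` are realised in `M^𝓔`. -/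
theorem exists_realizeSet_of_consistent (hS : H.SaturatedFor M κ μ) (hE : H.IsEquiv M)
    {X : Type u} (hX : #X < κ) {σ : X → HypSort H.Idx} {p : Set (Formula H.lang σ)}
    (hp : (extension hE).Consistent p) :
    ∃ b : RTuple M (RepVar σ), (str hE).RealizeSet p (clsTuple hE b) := by
  obtain ⟨N, hN, a, ha⟩ := hp
  obtain ⟨b, hb⟩ := hS.fiberCompact.exists_mem_iInter (hS.aleph0_le.trans hS.lt.le)
    (mk_repVar_lt hS σ hX)
    (D := fun φ : p => {b : RTuple M (RepVar σ) | (str hE).Realize φ.1 (clsTuple hE b)})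
    (fun φ => typeDefinable_realize hS hE hX φ.1) (by
      intro s
      obtain ⟨A, hA, hφ⟩ := Formula.exists_finite_support (conj (s.toList.map Subtype.val))
      have := hA.to_subtype
      obtain ⟨n, ⟨e⟩⟩ := Finite.exists_equiv_fin A
      let ι : Fin n → X := fun k => (e.symm k).1
      have hι : ι.Injective := Subtype.val_injective.comp e.symm.injective
      obtain ⟨φ, hφ⟩ := hφ ι fun x hx => ⟨e ⟨x, hx⟩, by simp [ι]⟩
      -- If `φ` had no solution in `M^𝓔`, the h-inductive sentence `∀ x (φ → ⊥)` would belong to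
      -- `T^𝓔` and fail in `N`.
      have hex : ∃ c : (str hE).Tuple fun k => σ (ι k), (str hE).Realize φ c := by
        by_contra! hcon
        refine hN ⟨n, fun k => σ (ι k), φ, .bot⟩ (fun c hc => (hcon c hc).elim)
          (fun k => a (ι k)) ((hφ N a).2 ((N.realize_conj _ _).2 fun χ hχ => ?_))
        obtain ⟨χ, -, rfl⟩ := List.mem_map.1 hχ
        exact ha _ χ.2
      obtain ⟨c, hc⟩ := hex
      have : ∀ x, ∃ d : (str hE).carrier (σ x), ∀ k (hk : ι k = x), hk ▸ c k = d := by
        intro x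
        by_cases hx : ∃ k, ι k = x
        · obtain ⟨k, rfl⟩ := hx
          refine ⟨c k, fun k' hk => ?_⟩
          obtain rfl := hι hk
          rfl
        · obtain ⟨d⟩ := nonempty_of_extension hE hN (a x)
          exact ⟨d, fun k hk => (hx ⟨k, hk⟩).elim⟩
      choose d hd using this
      obtain ⟨b, hb⟩ := clsTuple_surjective hE (d : (str hE).Tuple σ)
      refine ⟨b, fun χ hχ => ?_⟩
      have hcd : c = fun k => d (ι k) := funext fun k => hd _ k rfl
      rw [hcd] at hc
      refine ((str hE).realize_conj _ _).1 ((hφ (str hE) _).1 ?_) χ.1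
        (List.mem_map.2 ⟨χ, by simpa using hχ, rfl⟩)
      rw [hb]
      exact hc)
  exact ⟨b, fun φ hφ => hb ⟨φ, hφ⟩⟩

end HypFamily


/-! ### Renaming in types, and uniform separation -/

theorem Str.tp_comp_subset {S : Type u} {L : Signature S} (M : Str L) {X : Type*} {X' : Type*}
    {σ : X' → S} (f : X → X') {a b : M.Tuple σ} (h : M.tp a ⊆ M.tp b) :
    M.tp (σ := fun x => σ (f x)) (fun x => a (f x)) ⊆
      M.tp (σ := fun x => σ (f x)) fun x => b (f x) :=
  fun φ hφ => (M.realize_rename f φ b).1 (h ((M.realize_rename f φ a).2 hφ))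

theorem Str.tp_comp_eq {S : Type u} {L : Signature S} (M : Str L) {X : Type*} {X' : Type*}
    {σ : X' → S} (f : X → X') {a b : M.Tuple σ} (h : M.tp a = M.tp b) :
    M.tp (σ := fun x => σ (f x)) (fun x => a (f x)) =
      M.tp (σ := fun x => σ (f x)) fun x => b (f x) :=
  (M.tp_comp_subset f h.subset).antisymm (M.tp_comp_subset f h.symm.subset)

theorem Str.Indiscernible.comp {S : Type u} {L : Signature S} {M : Str L} {X : Type*} {X' : Type*}
    {σ : X' → S} (f : X → X') {a : ℕ → M.Tuple σ} (h : M.Indiscernible a) :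
    M.Indiscernible (σ := fun x => σ (f x)) fun i x => a i (f x) :=
  fun n i j hi hj => M.tp_comp_eq (σ := fun p : Fin n × X' => σ p.2) (Prod.map id f) (h n i j hi hj)

theorem Str.indiscernible_of_tp_eq {S : Type u} {L : Signature S} {M : Str L} {X : Type*}
    {σ : X → S} {a b : ℕ → M.Tuple σ} (ha : M.Indiscernible a)
    (h : M.tp (σ := fun p : ℕ × X => σ p.2) (fun p => a p.1 p.2) =
      M.tp (σ := fun p : ℕ × X => σ p.2) fun p => b p.1 p.2) : M.Indiscernible b := by
  have key : ∀ (n : ℕ) (i : Fin n → ℕ), M.tp (σ := fun p : Fin n × X => σ p.2)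
      (fun p => a (i p.1) p.2) = M.tp (σ := fun p : Fin n × X => σ p.2) fun p => b (i p.1) p.2 :=
    fun n i => M.tp_comp_eq (σ := fun p : ℕ × X => σ p.2) (Prod.map i id) h
  intro n i j hi hj
  rw [← key, ← key]
  exact ha n i j hi hj

/-- Disjointness from a type-definable set can be separated uniformly. -/
theorem FiberCompact.exists_separation {L : OneSorted.{u}} {M : Str L} {κ : Cardinal.{u}}
    (hM : FiberCompact κ M) (hκ : ℵ₀ ≤ κ) {Y : Type u} (hY : #Y < κ) (P : Set (RTuple M Y))
    {Q : Set (RTuple M Y)} (hQ : TypeDefinable Q)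
    (h : ∀ b ∈ Q, ∃ φ ψ : RFormula L Y, (∀ a ∈ P, ¬ M.Realize φ a) ∧ ¬ M.Realize ψ b ∧
      ∀ d : RTuple M Y, M.Realize φ d ∨ M.Realize ψ d) :
    ∃ φ ψ : RFormula L Y, (∀ a ∈ P, ¬ M.Realize φ a) ∧ (∀ b ∈ Q, ¬ M.Realize ψ b) ∧
      ∀ d : RTuple M Y, M.Realize φ d ∨ M.Realize ψ d := by
  classical
  choose φ ψ hφ hψ hor using fun b : Q => h b b.2
  let D : Option Q → Set (RTuple M Y)
    | none => Q
    | some b => {d | M.Realize (ψ b) d}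
  -- No point of `Q` satisfies all the `ψ b`, so by compactness finitely many of them already
  -- exclude `Q`.
  have hs : ∃ s : Finset (Option Q), ∀ d, ∃ i ∈ s, d ∉ D i := by
    by_contra! hcon
    obtain ⟨d, hd⟩ := hM.exists_mem_iInter hκ hY (D := D) (by
      rintro (_ | b)
      · exact hQ
      · exact typeDefinable_formula _) hcon
    exact hψ ⟨d, hd none⟩ (hd (some ⟨d, hd none⟩))
  obtain ⟨s, hs⟩ := hs
  refine ⟨disj (s.eraseNone.toList.map φ), conj (s.eraseNone.toList.map ψ),
    fun a ha hφa => ?_, fun b hb hψb => ?_, fun d => ?_⟩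
  · obtain ⟨χ, hχ, hχa⟩ := (M.realize_disj _ _).1 hφa
    obtain ⟨b, -, rfl⟩ := List.mem_map.1 hχ
    exact hφ b a ha hχa
  · obtain ⟨_ | b', hi, hbi⟩ := hs b
    · exact hbi hb
    · exact hbi ((M.realize_conj _ _).1 hψb _ (List.mem_map.2 ⟨b', by simpa using hi, rfl⟩))
  · by_cases hd : M.Realize (conj (s.eraseNone.toList.map ψ)) d
    · exact .inr hd
    · rw [Str.realize_conj] at hd
      push Not at hd
      obtain ⟨χ, hχ, hχd⟩ := hd
      obtain ⟨b, hb, rfl⟩ := List.mem_map.1 hχ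
      exact .inl ((M.realize_disj _ _).2
        ⟨φ b, List.mem_map.2 ⟨b, hb, rfl⟩, (hor b d).resolve_right hχd⟩)

/-! ### Transfer of the three properties -/

namespace HypFamily

variable {L : OneSorted.{u}} {H : HypFamily L} {T : Theory L} {M : Str L} {κ μ B : Cardinal.{u}}

theorem consistent_tp (hE : H.IsEquiv M) {X : Type u} {σ : X → HypSort H.Idx}
    (c : (str hE).Tuple σ) : (extension hE).Consistent ((str hE).tp c) :=
  ⟨str hE, fun _ h => h, c, fun _ h => h⟩

theorem tp_clsTuple_eq (hS : H.SaturatedFor M κ μ) (hE : H.IsEquiv M) {X : Type u}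
    (hX : #X < κ) {σ : X → HypSort H.Idx} {a b : RTuple M (RepVar σ)}
    (h : M.tp (σ := fun _ => PUnit.unit) a = M.tp (σ := fun _ => PUnit.unit) b) :
    (str hE).tp (clsTuple hE a) = (str hE).tp (clsTuple hE b) :=
  (tp_clsTuple_subset hS hE hX h.subset).antisymm (tp_clsTuple_subset hS hE hX h.symm.subset)

theorem isHausdorff_extension (hT : T.IsEC M) (hS : H.SaturatedFor M κ μ) (hE : H.IsEquiv M)
    (h : T.IsHausdorff κ M) : (extension hE).IsHausdorff κ (str hE) := by
  intro X σ hX p q hp hq hpq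
  have hκ : ℵ₀ ≤ κ := hS.aleph0_le.trans hS.lt.le
  have hY := mk_repVar_lt hS σ hX
  have hdef : ∀ p : Set (Formula H.lang σ),
      TypeDefinable {b : RTuple M (RepVar σ) | (str hE).RealizeSet p (clsTuple hE b)} := by
    intro p
    convert TypeDefinable.iInter fun φ : p => typeDefinable_realize hS hE hX φ.1 using 1
    ext b
    simp [Str.RealizeSet]
  have htp : ∀ p, (extension hE).IsType p → ∀ b : RTuple M (RepVar σ),
      (str hE).RealizeSet p (clsTuple hE b) → (str hE).tp (clsTuple hE b) = p :=
    fun p hp b hb => (hp.eq_of_subset (consistent_tp hE _) hb).symm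
  have hsep : ∀ a, (str hE).RealizeSet p (clsTuple hE a) →
      ∀ b, (str hE).RealizeSet q (clsTuple hE b) → ∃ φ ψ : RFormula L (RepVar σ),
        ¬ M.Realize φ a ∧ ¬ M.Realize ψ b ∧ ∀ d, M.Realize φ d ∨ M.Realize ψ d :=
    fun a ha b hb => h _ _ hY _ _ (hT.isType_tp a) (hT.isType_tp b) fun hab =>
      hpq (by rw [← htp p hp a ha, ← htp q hq b hb, tp_clsTuple_eq hS hE hX hab])
  -- The inner separation fixes a realisation `a` of `p` and is uniform over `q`; the outer one,
  -- with the two sides exchanged, makes it uniform over `p` as well.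
  obtain ⟨ψ, φ, hψ, hφ, hor⟩ := hS.fiberCompact.exists_separation hκ hY
    {b : RTuple M (RepVar σ) | (str hE).RealizeSet q (clsTuple hE b)} (hdef p) fun a ha => by
      obtain ⟨φ, ψ, hφ, hψ, hor⟩ := hS.fiberCompact.exists_separation hκ hY {a} (hdef q)
        fun b hb => by
          obtain ⟨φ, ψ, hφ, hψ, hor⟩ := hsep a ha b hb
          exact ⟨φ, ψ, by rintro _ rfl; exact hφ, hψ, hor⟩
      exact ⟨ψ, φ, hψ, hφ a rfl, fun d => (hor d).symm⟩
  have key : ∀ p : Set (Formula H.lang σ), (extension hE).IsType p → ∀ φ : RFormula L (RepVar σ),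
      (∀ b, (str hE).RealizeSet p (clsTuple hE b) → ¬ M.Realize φ b) →
      ∃ φ' : Formula H.lang σ, φ' ∉ p ∧
        ∀ b, M.Realize φ b → (str hE).Realize φ' (clsTuple hE b) := by
    intro p hp φ hφ
    obtain ⟨φ', hφ'⟩ := exists_repFormula hE φ
    refine ⟨φ', fun hmem => ?_, fun b hb => (hφ' _).2 ⟨b, rfl, hb⟩⟩
    -- Membership of `φ'` in `p` would give a realisation of `p` a representative satisfying `φ`,
    -- against the choice of `φ`.
    obtain ⟨b, hb⟩ := exists_realizeSet_of_consistent hS hE hX hp.prop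
    obtain ⟨b', hb', h⟩ := (hφ' _).1 (hb φ' hmem)
    exact hφ b' (hb' ▸ hb) h
  obtain ⟨φ', hφp, hφ'⟩ := key p hp φ hφ
  obtain ⟨ψ', hψq, hψ'⟩ := key q hq ψ hψ
  refine ⟨φ', ψ', hφp, hψq, fun c => ?_⟩
  obtain ⟨b, rfl⟩ := clsTuple_surjective hE c
  exact (hor b).symm.imp (hφ' b) (hψ' b)

/-- If `T` has a nonempty model, then `M^𝓔` contains tuples of all sorts. -/
theorem nonempty_tuple (hJ : T.JEP) (hT : T.IsEC M) (hE : H.IsEquiv M) {N : Str L}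
    (hN : N.Models T) (c : N.carrier PUnit.unit) {X : Type u} (σ : X → HypSort H.Idx) :
    Nonempty ((str hE).Tuple σ) := by
  obtain ⟨d⟩ := hT.nonempty_carrier hJ hN c
  exact ⟨clsTuple hE fun _ => d⟩

theorem isSemiHausdorff_extension (hJ : T.JEP) (hT : T.IsEC M) (hS : H.SaturatedFor M κ μ)
    (hE : H.IsEquiv M) (h : T.IsSemiHausdorff κ M) :
    (extension hE).IsSemiHausdorff κ (str hE) := by
  intro X σ hX
  have hκ : ℵ₀ ≤ κ := hS.aleph0_le.trans hS.lt.le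
  obtain ⟨Ω, -, hΩ⟩ := h (RepVar σ) (fun _ => PUnit.unit) (mk_repVar_lt hS σ hX)
  refine ⟨{χ | ∀ a b : (str hE).Tuple σ, (str hE).tp a = (str hE).tp b →
    (str hE).Realize χ ((str hE).append a b)}, ?_, fun a b => ⟨fun hab χ hχ => hχ a b hab, ?_⟩⟩
  · obtain ⟨-, ⟨N, hN, c, -⟩, -⟩ := h PUnit (fun _ => PUnit.unit)
      (by simpa using one_lt_aleph0.trans_le hκ)
    -- Consistency is witnessed by a diagonal pair, so `M^𝓔` must have a tuple of these sorts; this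
    -- is where joint embedding enters.
    obtain ⟨a⟩ := nonempty_tuple hJ hT hE hN (c (.inl PUnit.unit)) σ
    exact ⟨str hE, fun _ h => h, (str hE).append a a, fun χ hχ => hχ a a rfl⟩
  · intro hab
    let f : RepVar σ ⊕ RepVar σ → RepVar (Sum.elim σ σ) :=
      Sum.elim (fun z => ⟨.inl z.1, z.2⟩) fun z => ⟨.inr z.1, z.2⟩
    have hf : ∀ (d : RTuple M (RepVar (Sum.elim σ σ))),
        M.RealizeSet (Formula.rename (σ' := fun _ => PUnit.unit) f '' Ω) d ↔
        M.tp (σ := fun _ => PUnit.unit) (fun z => d (f (.inl z))) =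
          M.tp (σ := fun _ => PUnit.unit) fun z => d (f (.inr z)) := by
      intro d
      rw [hΩ, Str.RealizeSet, Set.forall_mem_image]
      refine forall₂_congr fun φ _ => (M.realize_rename _ _ _).trans (iff_of_eq ?_)
      congr 1
      funext z
      rcases z with z | z <;> rfl
    obtain ⟨d, hd, hdΩ⟩ := exists_rep_realizeSet hS hE
      (by simpa only [mk_sum, lift_id] using add_lt_of_lt hκ hX hX)
      (Formula.rename (σ' := fun _ => PUnit.unit) f '' Ω)
      {c | ∃ a b : (str hE).Tuple σ, (str hE).tp a = (str hE).tp b ∧ c = (str hE).append a b} (by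
        rintro _ ⟨a, b, hab, rfl⟩
        obtain ⟨a, rfl⟩ := clsTuple_surjective hE a
        obtain ⟨b, rfl, htp⟩ := exists_rep_tp_eq hT hS hE hX a b hab.subset
        let d : RTuple M (RepVar (Sum.elim σ σ)) := fun
          | ⟨.inl x, l⟩ => a ⟨x, l⟩
          | ⟨.inr x, l⟩ => b ⟨x, l⟩
        refine ⟨d, ?_, (hf d).2 htp⟩
        funext x
        rcases x with x | x <;> rfl)
      ((str hE).append a b) fun χ hχ => hab χ fun a b hab => hχ _ ⟨a, b, hab, rfl⟩
    have ha : clsTuple hE (fun z => d (f (.inl z))) = a := funext fun x => congrFun hd (.inl x)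
    have hb : clsTuple hE (fun z => d (f (.inr z))) = b := funext fun x => congrFun hd (.inr x)
    rw [← ha, ← hb]
    exact tp_clsTuple_eq hS hE hX ((hf d).1 hdΩ)

section Thick

variable {X : Type u} {σ : X → HypSort H.Idx}

/-- The variables of a family of representatives, as representatives of the family. -/
def repFamily {I : Type} (z : I × RepVar σ) : RepVar fun p : I × X => σ p.2 :=
  ⟨(z.1, z.2.1), z.2.2⟩

/-- The inverse of `repFamily`. -/
def familyRep {I : Type} (z : RepVar fun p : I × X => σ p.2) : I × RepVar σ :=
  (z.1.1, ⟨z.1.2, z.2⟩)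

theorem SaturatedFor.mk_prod_lt (hS : H.SaturatedFor M κ μ) (hX : #X < κ) (I : Type)
    [Countable I] : #(I × X) < κ := by
  have hκ : ℵ₀ < κ := hS.aleph0_le.trans_lt hS.lt
  rw [mk_prod, lift_uzero]
  exact mul_lt_of_lt hκ.le (lt_of_le_of_lt (by simp) hκ) (by simpa using hX)

theorem indiscernible_clsTuple (hS : H.SaturatedFor M κ μ) (hE : H.IsEquiv M) (hX : #X < κ)
    {a : ℕ → RTuple M (RepVar σ)} (ha : M.Indiscernible (σ := fun _ => PUnit.unit) a) :
    (str hE).Indiscernible fun i => clsTuple hE (a i) :=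
  fun n i j hi hj => tp_clsTuple_eq hS hE (X := Fin n × X) (hS.mk_prod_lt hX _)
    (M.tp_comp_eq (σ := fun _ => PUnit.unit) (familyRep (I := Fin n) (σ := σ)) (ha n i j hi hj))

/-- Indiscernible sequences of hyperimaginaries have indiscernible sequences of representatives. -/
theorem exists_indiscernible_rep (hT : T.IsEC M) (hS : H.SaturatedFor M κ μ) (hE : H.IsEquiv M)
    (hB : B.IsStrongLimit) (hB₀ : ℵ₀ < B) (hBκ : B ≤ κ) (hX : #X < κ)
    (hC : ∀ n, #(RFormula L (Fin n × RepVar σ)) < B) {c : ℕ → (str hE).Tuple σ}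
    (hc : (str hE).Indiscernible c) : ∃ a : ℕ → RTuple M (RepVar σ),
      (∀ i, clsTuple hE (a i) = c i) ∧ M.Indiscernible (σ := fun _ => PUnit.unit) a := by
  have hY := mk_repVar_lt hS σ hX
  choose a₀ ha₀ using fun i => clsTuple_surjective hE (c i)
  let initial (n : ℕ) := (str hE).tp (σ := fun p : Fin n × X => σ p.2) fun p => c p.1 p.2
  -- The pattern records that the classes of increasing `n`-tuples realise the type of the first `n`
  -- terms of `c`. This is a condition on representatives because that type is type-definable there.
  let Γ : Pattern L (RepVar σ) := {γ | ∀ b : RTuple M (RepVar fun p : Fin γ.1 × X => σ p.2),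
    (str hE).RealizeSet (initial γ.1) (clsTuple hE b) →
      M.Realize γ.2 fun z => b (repFamily z)}
  have hΓ : Γ.SatOn a₀ := by
    intro γ hγ i hi
    refine hγ (fun z => a₀ (i z.1.1) ⟨z.1.2, z.2⟩) ?_
    have hcls : clsTuple hE (σ := fun p : Fin γ.1 × X => σ p.2)
        (fun z => a₀ (i z.1.1) ⟨z.1.2, z.2⟩) = fun p : Fin γ.1 × X => c (i p.1) p.2 :=
      funext fun p => congrFun (ha₀ (i p.1)) p.2
    rw [hcls]
    exact (hc _ (fun k => k) i (fun _ _ h => h) hi).subset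
  obtain ⟨a, ha, hind⟩ := hΓ.exists_indiscernible hT hS.fiberCompact hB hB₀ hBκ hY hC
  let a' : RTuple M (RepVar fun p : ℕ × X => σ p.2) := fun z => a z.1.1 ⟨z.1.2, z.2⟩
  have hinit : ∀ n, initial n ⊆ (str hE).tp (σ := fun p : Fin n × X => σ p.2)
      fun p => clsTuple hE (a p.1) p.2 := by
    intro n χ hχ
    obtain ⟨Ψ, hΨ⟩ := typeDefinable_realize hS hE (hS.mk_prod_lt hX (Fin n)) χ
    have : (fun z => a z.1.1 ⟨z.1.2, z.2⟩ : RTuple M (RepVar fun p : Fin n × X => σ p.2)) ∈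
        {b : RTuple M (RepVar fun p : Fin n × X => σ p.2) |
          (str hE).Realize χ (clsTuple hE b)} := by
      rw [hΨ]
      intro ψ hψ
      have hmem : (⟨n, Formula.rename (σ' := fun _ => PUnit.unit) familyRep ψ⟩ :
          Σ n, RFormula L (Fin n × RepVar σ)) ∈ Γ := by
        intro b hb
        have hb' : b ∈ {b : RTuple M (RepVar fun p : Fin n × X => σ p.2) |
          (str hE).Realize χ (clsTuple hE b)} := hb χ hχ
        rw [hΨ] at hb'
        exact (M.realize_rename _ _ _).2 (hb' ψ hψ)
      exact (M.realize_rename _ _ _).1 (ha _ hmem (fun k => k) fun _ _ h => h)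
    exact this
  have hsub : (str hE).tp (σ := fun p : ℕ × X => σ p.2) (fun p => c p.1 p.2) ⊆
      (str hE).tp (clsTuple hE a') := by
    intro χ hχ
    obtain ⟨A, hA, hfin⟩ := Formula.exists_finite_support χ
    obtain ⟨n, hn⟩ := (hA.image Prod.fst).bddAbove
    obtain ⟨χ', hχ'⟩ := hfin (Prod.map (Fin.val : Fin (n + 1) → ℕ) (id : X → X)) (by
      rintro ⟨k, x⟩ hk
      exact ⟨(⟨k, Nat.lt_succ_of_le (hn ⟨_, hk, rfl⟩)⟩, x), rfl⟩)
    exact (hχ' (str hE) _).1 (hinit (n + 1) ((hχ' (str hE) _).2 hχ))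
  have hX' := hS.mk_prod_lt hX ℕ
  obtain ⟨d, hd⟩ := clsTuple_surjective hE (σ := fun p : ℕ × X => σ p.2) fun p => c p.1 p.2
  -- Lifting from `c` to the classes of `a'` turns the inclusion of types into an equality. A second
  -- lifting then replaces `a'` by representatives of `c` itself with the same real type.
  obtain ⟨b, hb, hdb⟩ := exists_rep_tp_eq hT hS hE hX' d (clsTuple hE a') (by rwa [hd])
  obtain ⟨b', hb', hab⟩ := exists_rep_tp_eq hT hS hE hX' a'
    (fun p : ℕ × X => c p.1 p.2 : (str hE).Tuple fun p : ℕ × X => σ p.2) (by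
      rw [← hb, ← hd]
      exact (tp_clsTuple_eq hS hE hX' hdb).symm.subset)
  refine ⟨fun i z => b' (repFamily (i, z)),
    fun i => funext fun x => congrFun hb' (i, x), ?_⟩
  exact Str.indiscernible_of_tp_eq hind
    (M.tp_comp_eq (σ := fun _ => PUnit.unit) (repFamily (I := ℕ) (σ := σ)) hab)

end Thick

/-- A small tuple may have `B` or more coordinates, too many for the extraction; finite subtuples
suffice because each formula has finite support. -/
theorem indiscernible_of_finite (hE : H.IsEquiv M) {X : Type u} {σ : X → HypSort H.Idx}
    (c : ℕ → (str hE).Tuple σ) (h : ∀ A : Set X, A.Finite →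
      (str hE).Indiscernible (σ := fun x : A => σ x) fun i x => c i x) :
    (str hE).Indiscernible c := by
  have key : ∀ (n : ℕ) (i j : Fin n → ℕ), StrictMono i → StrictMono j →
      (str hE).tp (σ := fun p : Fin n × X => σ p.2) (fun p => c (i p.1) p.2) ⊆
        (str hE).tp (σ := fun p : Fin n × X => σ p.2) fun p => c (j p.1) p.2 := by
    intro n i j hi hj χ hχ
    obtain ⟨A, hA, hfin⟩ := Formula.exists_finite_support χ
    obtain ⟨χ', hχ'⟩ := hfin (Prod.map (id : Fin n → Fin n) (Subtype.val : Prod.snd '' A → X)) (by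
      rintro ⟨k, x⟩ hk
      exact ⟨(k, ⟨x, _, hk, rfl⟩), rfl⟩)
    exact (hχ' (str hE) _).1
      ((h _ (hA.image Prod.snd) n i j hi hj).subset ((hχ' (str hE) _).2 hχ))
  exact fun n i j hi hj => (key n i j hi hj).antisymm (key n j i hj hi)

theorem isThick_extension (hJ : T.JEP) (hT : T.IsEC M) (hS : H.SaturatedFor M κ μ)
    (hE : H.IsEquiv M) (hF : #L.Func ≤ μ) (hR : #L.Rel ≤ μ) (hB : B.IsStrongLimit) (hμB : μ < B)
    (hBκ : B ≤ κ) (h : T.IsThick κ M) : (extension hE).IsThick κ (str hE) := by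
  intro X σ hX
  have hμ := hS.aleph0_le
  refine ⟨{χ | ∀ c : ℕ → (str hE).Tuple σ, (str hE).Indiscernible c →
    (str hE).Realize χ fun p => c p.1 p.2}, ?_, fun c => ⟨fun hc χ hχ => hχ c hc, fun hc => ?_⟩⟩
  · obtain ⟨-, ⟨N, hN, d, -⟩, -⟩ := h PUnit (fun _ => PUnit.unit)
      (by simpa using one_lt_aleph0.trans_le (hμ.trans hS.lt.le))
    obtain ⟨a⟩ := nonempty_tuple hJ hT hE hN (d (0, PUnit.unit)) σ
    exact ⟨str hE, fun _ h => h, fun p => a p.2, fun χ hχ => hχ (fun _ => a) fun _ _ _ _ _ => rfl⟩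
  refine indiscernible_of_finite hE c fun A hA => ?_
  let τ : A → HypSort H.Idx := fun x => σ x
  have hAκ : #A < κ := (mk_set_le A).trans_lt hX
  have hY : #(RepVar τ) ≤ μ := (mk_repVar_le hμ hS.len_le τ).trans
    (mul_le_of_le hμ (hA.lt_aleph0.le.trans hμ) le_rfl)
  have hC : ∀ n, #(RFormula L (Fin n × RepVar τ)) < B := fun n =>
    (mk_formula_le _ hμ (by
      rw [mk_prod, lift_uzero]
      exact mul_le_of_le hμ (by simpa using (natCast_lt_aleph0 (n := n)).le.trans hμ)
        (by simpa using hY)) hF hR (by simpa using one_lt_aleph0.le.trans hμ)).trans_lt hμB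
  obtain ⟨Θ, -, hΘ⟩ := h (RepVar τ) (fun _ => PUnit.unit) (hY.trans_lt hS.lt)
  have hf : ∀ d : RTuple M (RepVar fun p : ℕ × A => τ p.2),
      M.RealizeSet (Formula.rename (σ' := fun _ => PUnit.unit) repFamily '' Θ) d ↔
        M.Indiscernible (σ := fun _ => PUnit.unit) fun i z => d (repFamily (i, z)) := by
    intro d
    rw [hΘ, Str.RealizeSet, Set.forall_mem_image]
    exact forall₂_congr fun φ _ => M.realize_rename _ _ _
  obtain ⟨d, hd, hdΘ⟩ := exists_rep_realizeSet hS hE (hS.mk_prod_lt hAκ ℕ)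
    (Formula.rename (σ' := fun _ => PUnit.unit) repFamily '' Θ)
    {c | ∃ c' : ℕ → (str hE).Tuple σ, (str hE).Indiscernible c' ∧
      c = fun p : ℕ × A => c' p.1 p.2} (by
      rintro _ ⟨c', hc', rfl⟩
      obtain ⟨a, ha, hind⟩ := exists_indiscernible_rep hT hS hE hB (hμ.trans_lt hμB) hBκ hAκ hC
        (hc'.comp (Subtype.val : A → X))
      exact ⟨fun z => a z.1.1 ⟨z.1.2, z.2⟩, funext fun p => congrFun (ha p.1) p.2, (hf _).2 hind⟩)
    (fun p => c p.1 p.2) fun χ hχ => by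
      -- A formula about the coordinates in `A` is read as one about all of `X`, where the
      -- assumption on `c` applies.
      refine ((str hE).realize_rename (σ' := fun p : ℕ × X => σ p.2)
        (Prod.map id Subtype.val : ℕ × A → ℕ × X) χ _).1 (hc _ fun c' hc' => ?_)
      exact ((str hE).realize_rename (σ' := fun p : ℕ × X => σ p.2)
        (Prod.map id Subtype.val : ℕ × A → ℕ × X) χ _).2 (hχ _ ⟨c', hc', rfl⟩)
  have := indiscernible_clsTuple hS hE hAκ ((hf d).1 hdΘ)
  convert this using 2 with i
  exact funext fun x => (congrFun hd (i, x)).symm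

end HypFamily

end PosLogic

theorem mainTheorem10 {L : PosLogic.OneSorted.{u}} (T : PosLogic.Theory L)
    (M : PosLogic.Str L) (H : PosLogic.HypFamily L) (κ μ : Cardinal.{u})
    -- `κ`, the bound for smallness, is sufficiently large
    (hμ : ℵ₀ ≤ μ) (hFunc : #L.Func ≤ μ) (hRel : #L.Rel ≤ μ) (hLen : ∀ e, #(H.Len e) ≤ μ)
    (hκ : Cardinal.beth (Order.succ ((2 : Cardinal.{u}) ^ μ)).ord < κ)
    (hT : T.JEP) (hM : T.IsMonster κ M) (hE : H.IsEquiv M) :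
    (T.IsHausdorff κ M →
      (PosLogic.HypFamily.extension hE).IsHausdorff κ (PosLogic.HypFamily.str hE)) ∧
    (T.IsSemiHausdorff κ M →
      (PosLogic.HypFamily.extension hE).IsSemiHausdorff κ (PosLogic.HypFamily.str hE)) ∧
    (T.IsThick κ M →
      (PosLogic.HypFamily.extension hE).IsThick κ (PosLogic.HypFamily.str hE)) := by
  -- The strong limit cardinal `B` is taken to be `ℶ` at `(2^μ)⁺`.
  have hμB : μ < Cardinal.beth (Order.succ ((2 : Cardinal.{u}) ^ μ)).ord :=
    (cantor μ).trans ((Order.lt_succ _).trans_le (le_beth_ord _))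
  have hB : (Cardinal.beth (Order.succ ((2 : Cardinal.{u}) ^ μ)).ord).IsStrongLimit :=
    isStrongLimit_beth.2 (isSuccLimit_ord
      ((hμ.trans (cantor μ).le).trans (Order.le_succ _))).isSuccPrelimit
  have hμκ := hμB.trans hκ
  have hS : H.SaturatedFor M κ μ := by
    refine ⟨hM.fiberCompact (fun Y hY => ?_) (hμ.trans hμκ.le), hμ, hμκ, hLen⟩
    exact (PosLogic.mk_formula_le _ (hμ.trans (le_max_left μ #Y)) (le_max_right _ _)
      (hFunc.trans (le_max_left _ _)) (hRel.trans (le_max_left _ _))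
      (by simpa using Or.inl (one_lt_aleph0.le.trans hμ))).trans_lt (max_lt hμκ hY)
  exact ⟨PosLogic.HypFamily.isHausdorff_extension hM.ec hS hE,
    PosLogic.HypFamily.isSemiHausdorff_extension hT hM.ec hS hE,
    PosLogic.HypFamily.isThick_extension hT hM.ec hS hE hFunc hRel hB hμB hκ.le⟩
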